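/- Let $M\subseteq\mathbb R^n$ be one of the following: an open ball $\{|x|<\nu\}$ with $\nu>0$, a spherical shell $\{\nu_2\le|x|<\nu_1\}$ or $\{\nu_2<|x|<\nu_1\}$ with $0\le\nu_2<\nu_1$, or $\mathbb R^n$ itself. Let $m\in\{0,1,2,\dots\}$, let $\gamma\ge 0$ and $\epsilon>0$ be real constants, and let $h$ be a real function such that $x\mapsto h(|x|)$ is $C^\infty$ on $M$. Put $$\phi_m(r,s)=s\,h(r)-\gamma\sum_{i=0}^{m}(-1)^{m-i}\binom mi r^{2i}e^{r^2}\,s\!\int s^{2(m-i-1)}e^{-s^2}\,ds+\epsilon\, e^{r^2-s^2}\bigl(\sqrt\pi\,s\,e^{s^2}\operatorname{erf}(s)+1\bigr),$$ where $\operatorname{erf}(x)=\frac{2}{\sqrt\pi}\int_0^x e^{-t^2}dt$ and $s\int s^{2(m-i-1)}e^{-s^2}ds$ stands for any differentiable function $\Phi_i:\mathbb R\to\mathbb R$ such that $\frac{d}{ds}\bigl(\Phi_i(s)/s\bigr)=s^{2(m-i-1)}e^{-s^2}$ for all $s\neq 0$. Suppose that $\phi_m(|x|,s)>0$ for all $x\in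 M$ and all $s$ with $|s|\le|x|$. Then $$F(x,y)=|y|\,\phi_m\Bigl(|x|,\frac{\langle x,y\rangle}{|y|}\Bigr),\qquad F(x,0)=0,$$ is a Finsler metric on $M$ (that is, $F$ is $C^\infty$ on $\{(x,y):x\in M,\ y\ne0\}$, and for each $x\in M$ the function $F(x,\cdot)$ is positive off $0$, positively homogeneous of degree one, and has positive definite fundamental tensor $g_{ij}=\frac12[F^2]_{y^iy^j}$ at every $y\neq0$), it is projectively flat (its geodesics are straight lines in the coordinates of $\mathbb R^n$), and it is of scalar flag curvature (the flag curvature $K(P,y)$ depends only on $(x,y)$, not on the plane $P\ni y$). -/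

import Mathlib

open scoped ContDiff

noncomputable section

namespace SphFinsler

/-- Euclidean space `ℝⁿ`. -/
abbrev E (n : ℕ) := EuclideanSpace ℝ (Fin n)

/-- The domains `M_sⁿ`: open balls centred at the origin, spherical shells (with or without their
inner boundary sphere), and the whole space. -/
inductive IsSymmetricDomain {n : ℕ} : Set (E n) → Prop
  | ball (ν : ℝ) (hν : 0 < ν) : IsSymmetricDomain {x | ‖x‖ < ν}
  | shell (ν₁ ν₂ : ℝ) (h₂ : 0 ≤ ν₂) (h₁ : ν₂ < ν₁) : IsSymmetricDomain {x | ν₂ ≤ ‖x‖ ∧ ‖x‖ < ν₁}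
  | openShell (ν₁ ν₂ : ℝ) (h₂ : 0 ≤ ν₂) (h₁ : ν₂ < ν₁) :
      IsSymmetricDomain {x | ν₂ < ‖x‖ ∧ ‖x‖ < ν₁}
  | univ : IsSymmetricDomain Set.univ

/-! ### Finsler geometry in the standard coordinates `(x, y)` of `TM = M × ℝⁿ`

A function on `TM` is a curried function of `x` and `y`. Derivatives in `x` are taken within `M`;
on an open `M` they are the ordinary partial derivatives. -/

variable {n : ℕ}

/-- `∂f/∂xᵏ`. -/
def dX (M : Set (E n)) (f : E n → E n → ℝ) (k : Fin n) : E n → E n → ℝ := fun x y =>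
  fderivWithin ℝ (fun x' => f x' y) M x (EuclideanSpace.single k 1)

/-- `∂f/∂yᵏ`. -/
def dY (f : E n → E n → ℝ) (k : Fin n) : E n → E n → ℝ := fun x y =>
  fderiv ℝ (fun y' => f x y') y (EuclideanSpace.single k 1)

/-- `F²`. -/
def sq (F : E n → E n → ℝ) : E n → E n → ℝ := fun x y => F x y ^ 2

/-- The fundamental tensor `g_{ij} = ½ [F²]_{yⁱ yʲ}`. -/
def fundamentalTensor (F : E n → E n → ℝ) (x y : E n) : Matrix (Fin n) (Fin n) ℝ :=
  Matrix.of fun i j => (1 / 2) * dY (dY (sq F) i) j x y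

/-- The bilinear form `g_y(u, v) = g_{ij} uⁱ vʲ`. -/
def gForm (F : E n → E n → ℝ) (x y u v : E n) : ℝ :=
  ∑ i, ∑ j, fundamentalTensor F x y i j * u i * v j

/-- A Finsler metric on `M`: smooth off the zero section, and a Minkowski norm (positive,
positively homogeneous of degree one, strongly convex) on every tangent space. -/
structure IsFinslerMetric (M : Set (E n)) (F : E n → E n → ℝ) : Prop where
  smooth : ContDiffOn ℝ ∞ (fun p : E n × E n => F p.1 p.2) (M ×ˢ {y | y ≠ 0})
  zero : ∀ x ∈ M, F x 0 = 0
  pos : ∀ x ∈ M, ∀ y, y ≠ 0 → 0 < F x y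
  homogeneous : ∀ x ∈ M, ∀ y, ∀ t : ℝ, 0 < t → F x (t • y) = t * F x y
  stronglyConvex : ∀ x ∈ M, ∀ y, y ≠ 0 → (fundamentalTensor F x y).PosDef

/-- The geodesic coefficients `Gⁱ = ¼ gⁱˡ ([F²]_{xᵏ yˡ} yᵏ - [F²]_{xˡ})`. -/
def geodesicCoeff (M : Set (E n)) (F : E n → E n → ℝ) (i : Fin n) : E n → E n → ℝ := fun x y =>
  (1 / 4) * ∑ l, (fundamentalTensor F x y)⁻¹ i l *
    ((∑ k, dY (dX M (sq F) k) l x y * y k) - dX M (sq F) l x y)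

/-- `c` is a (non-constant, constant speed) geodesic of `F` on the set `I` of parameters:
it stays in `M` and `c'' + 2 G(c, c') = 0`. -/
def IsGeodesicOn (M : Set (E n)) (F : E n → E n → ℝ) (c : ℝ → E n) (I : Set ℝ) : Prop :=
  ∃ v : ℝ → E n, ∀ t ∈ I, c t ∈ M ∧ v t ≠ 0 ∧ HasDerivAt c (v t) t ∧
    HasDerivAt v (WithLp.toLp 2 fun i => -2 * geodesicCoeff M F i (c t) (v t)) t

/-- `F` is projectively flat on `M`: its geodesics are straight. -/
def IsProjectivelyFlat (M : Set (E n)) (F : E n → E n → ℝ) : Prop :=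
  ∀ (c : ℝ → E n) (I : Set ℝ), IsOpen I → I.OrdConnected → IsGeodesicOn M F c I →
    Collinear ℝ (c '' I)

/-- The Riemann curvature
`Rⁱ_k = 2 ∂Gⁱ/∂xᵏ - yʲ ∂²Gⁱ/∂xʲ∂yᵏ + 2 Gʲ ∂²Gⁱ/∂yʲ∂yᵏ - ∂Gⁱ/∂yʲ ∂Gʲ/∂yᵏ`. -/
def riemannCurvature (M : Set (E n)) (F : E n → E n → ℝ) (i k : Fin n) (x y : E n) : ℝ :=
  2 * dX M (geodesicCoeff M F i) k x y
    - ∑ j, y j * dY (dX M (geodesicCoeff M F i) j) k x y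
    + 2 * ∑ j, geodesicCoeff M F j x y * dY (dY (geodesicCoeff M F i) j) k x y
    - ∑ j, dY (geodesicCoeff M F i) j x y * dY (geodesicCoeff M F j) k x y

/-- The vector `R_y(u)`, with components `Rⁱ_k uᵏ`. -/
def riemannMap (M : Set (E n)) (F : E n → E n → ℝ) (x y u : E n) : E n :=
  WithLp.toLp 2 fun i => ∑ k, riemannCurvature M F i k x y * u k

/-- The flag curvature `K(P, y)` of the flag `P = span {y, u}` with flagpole `y`. -/
def flagCurvature (M : Set (E n)) (F : E n → E n → ℝ) (x y u : E n) : ℝ :=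
  gForm F x y (riemannMap M F x y u) u /
    (gForm F x y y y * gForm F x y u u - gForm F x y y u ^ 2)

/-- `F` is of scalar flag curvature: `K(P, y) = K(x, y)` does not depend on the plane `P ∋ y`. -/
def HasScalarFlagCurvature (M : Set (E n)) (F : E n → E n → ℝ) : Prop :=
  ∃ K : E n → E n → ℝ, ∀ x ∈ M, ∀ y u : E n, LinearIndependent ℝ ![y, u] →
    flagCurvature M F x y u = K x y

/-- The spherically symmetric function `F(x, y) = |y| φ(|x|, ⟨x, y⟩ / |y|)`. -/
def sphericalMetric (φ : ℝ → ℝ → ℝ) (x y : E n) : ℝ :=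
  ‖y‖ * φ ‖x‖ (inner ℝ x y / ‖y‖)

/-! ### The family `φ_m` -/

/-- The Gauss error function. -/
def erf (x : ℝ) : ℝ := 2 / Real.sqrt Real.pi * ∫ t in (0 : ℝ)..x, Real.exp (-t ^ 2)

/-- `Φ` is a determination of `s ∫ sᵏ e^{-s²} ds`: it is differentiable on `ℝ`, and `Φ(s) / s` is a
primitive of `sᵏ e^{-s²}` for `s ≠ 0`. (For `k = -2` the primitive itself is singular at `0`,
whereas its product with `s` extends smoothly.) -/
def IsMulPrimitive (k : ℤ) (Φ : ℝ → ℝ) : Prop :=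
  Differentiable ℝ Φ ∧
    ∀ s : ℝ, s ≠ 0 → HasDerivAt (fun t => Φ t / t) (s ^ k * Real.exp (-s ^ 2)) s

/-- `φ_m(r, s)`, where `Φ i` stands for `s ∫ s^{2(m-i-1)} e^{-s²} ds`. -/
def phi (m : ℕ) (γ ε : ℝ) (h : ℝ → ℝ) (Φ : ℕ → ℝ → ℝ) (r s : ℝ) : ℝ :=
  s * h r
    - γ * ∑ i ∈ Finset.range (m + 1),
        (-1) ^ (m - i) * (m.choose i : ℝ) * r ^ (2 * i) * Real.exp (r ^ 2) * Φ i s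
    + ε * Real.exp (r ^ 2 - s ^ 2) *
        (Real.sqrt Real.pi * s * Real.exp (s ^ 2) * erf s + 1)

end SphFinsler

end

noncomputable section
namespace SphFinsler

variable {n : ℕ}

/-! ### Calculus on the slit tangent bundle -/

/-- The slit tangent bundle of `M`. -/
def slit (M : Set (E n)) : Set (E n × E n) := M ×ˢ {y | y ≠ 0}

/-- `f` is smooth on the slit tangent bundle. -/
def SmoothTM (M : Set (E n)) (f : E n → E n → ℝ) : Prop :=
  ContDiffOn ℝ ∞ (fun p : E n × E n => f p.1 p.2) (slit M)

/-- Sets on which derivatives within the set are unique and second derivatives are symmetric. -/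
structure RegularDomain (M : Set (E n)) : Prop where
  uniqueDiffOn : UniqueDiffOn ℝ M
  subset_closure_interior : M ⊆ closure (interior M)

/-- The directional derivative on the slit tangent bundle. -/
def dirDeriv (M : Set (E n)) (f : E n → E n → ℝ) (w : E n × E n) : E n → E n → ℝ := fun x y =>
  fderivWithin ℝ (fun p : E n × E n => f p.1 p.2) (slit M) (x, y) w

lemma isOpen_ne_zero : IsOpen {y : E n | y ≠ 0} := isOpen_ne

variable {M : Set (E n)} {f g : E n → E n → ℝ} {x y : E n}

lemma RegularDomain.uniqueDiffOn_slit (hM : RegularDomain M) : UniqueDiffOn ℝ (slit M) :=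
  hM.uniqueDiffOn.prod isOpen_ne_zero.uniqueDiffOn

lemma RegularDomain.slit_subset (hM : RegularDomain M) :
    slit M ⊆ closure (interior (slit M)) := by
  rw [slit, interior_prod_eq, closure_prod_eq, isOpen_ne_zero.interior_eq]
  exact Set.prod_mono hM.subset_closure_interior subset_closure

lemma SmoothTM.differentiableWithinAt (hf : SmoothTM M f) (hx : x ∈ M) (hy : y ≠ 0) :
    DifferentiableWithinAt ℝ (fun p : E n × E n => f p.1 p.2) (slit M) (x, y) :=
  (hf.differentiableOn (by simp)) (x, y) ⟨hx, hy⟩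

lemma SmoothTM.hasFDerivWithinAt_left (hf : SmoothTM M f) (hx : x ∈ M) (hy : y ≠ 0) :
    HasFDerivWithinAt (fun x' => f x' y)
      ((fderivWithin ℝ (fun p : E n × E n => f p.1 p.2) (slit M) (x, y)).comp
        (ContinuousLinearMap.inl ℝ (E n) (E n))) M x := by
  have h : HasFDerivWithinAt (fun z : E n => (z, y)) (ContinuousLinearMap.inl ℝ (E n) (E n)) M x :=
    (hasFDerivAt_prodMk_left x y).hasFDerivWithinAt
  exact (hf.differentiableWithinAt hx hy).hasFDerivWithinAt.comp x h
    (show Set.MapsTo _ M (slit M) from fun _ hz => ⟨hz, hy⟩)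

lemma SmoothTM.hasFDerivAt_right (hf : SmoothTM M f) (hx : x ∈ M) (hy : y ≠ 0) :
    HasFDerivAt (fun y' => f x y')
      ((fderivWithin ℝ (fun p : E n × E n => f p.1 p.2) (slit M) (x, y)).comp
        (ContinuousLinearMap.inr ℝ (E n) (E n))) y :=
  ((hf.differentiableWithinAt hx hy).hasFDerivWithinAt.comp y
    (hasFDerivAt_prodMk_right x y).hasFDerivWithinAt (t := slit M) (s := {y | y ≠ 0})
      (fun _ hz => ⟨hx, hz⟩)).hasFDerivAt (isOpen_ne_zero.mem_nhds hy)

lemma SmoothTM.diffX (hf : SmoothTM M f) (hx : x ∈ M) (hy : y ≠ 0) :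
    DifferentiableWithinAt ℝ (fun x' => f x' y) M x :=
  (hf.hasFDerivWithinAt_left hx hy).differentiableWithinAt

lemma SmoothTM.diffY (hf : SmoothTM M f) (hx : x ∈ M) (hy : y ≠ 0) :
    DifferentiableAt ℝ (fun y' => f x y') y :=
  (hf.hasFDerivAt_right hx hy).differentiableAt

lemma dX_eq_dirDeriv (hM : RegularDomain M) (hf : SmoothTM M f) (k : Fin n) (hx : x ∈ M)
    (hy : y ≠ 0) : dX M f k x y = dirDeriv M f (EuclideanSpace.single k 1, 0) x y := by
  rw [dX, (hf.hasFDerivWithinAt_left hx hy).fderivWithin (hM.uniqueDiffOn x hx)]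
  simp [dirDeriv]

lemma dY_eq_dirDeriv (hf : SmoothTM M f) (k : Fin n) (hx : x ∈ M)
    (hy : y ≠ 0) : dY f k x y = dirDeriv M f (0, EuclideanSpace.single k 1) x y := by
  rw [dY, (hf.hasFDerivAt_right hx hy).fderiv]
  simp [dirDeriv]

lemma SmoothTM.congr (hf : SmoothTM M f) (h : ∀ x ∈ M, ∀ y, y ≠ 0 → g x y = f x y) :
    SmoothTM M g :=
  ContDiffOn.congr hf fun p hp => h p.1 hp.1 p.2 hp.2

lemma SmoothTM.dirDeriv (hM : RegularDomain M) (hf : SmoothTM M f) (w : E n × E n) :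
    SmoothTM M (dirDeriv M f w) :=
  (ContDiffOn.fderivWithin hf hM.uniqueDiffOn_slit (m := ∞) (by simp)).clm_apply contDiffOn_const

lemma SmoothTM.dX (hM : RegularDomain M) (hf : SmoothTM M f) (k : Fin n) :
    SmoothTM M (dX M f k) :=
  (hf.dirDeriv hM _).congr fun _ hx _ hy => dX_eq_dirDeriv hM hf k hx hy

lemma SmoothTM.dY (hM : RegularDomain M) (hf : SmoothTM M f) (k : Fin n) :
    SmoothTM M (dY f k) :=
  (hf.dirDeriv hM _).congr fun _ hx _ hy => dY_eq_dirDeriv hf k hx hy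

lemma dirDeriv_congr (h : ∀ x ∈ M, ∀ y, y ≠ 0 → f x y = g x y) (w : E n × E n) (hx : x ∈ M)
    (hy : y ≠ 0) : dirDeriv M f w x y = dirDeriv M g w x y := by
  unfold dirDeriv
  have hc : ∀ p ∈ slit M, f p.1 p.2 = g p.1 p.2 := fun p hp => h p.1 hp.1 p.2 hp.2
  rw [fderivWithin_congr hc (h x hx y hy)]

lemma dX_congr (h : ∀ x ∈ M, ∀ y, y ≠ 0 → f x y = g x y) (k : Fin n) (hx : x ∈ M)
    (hy : y ≠ 0) : dX M f k x y = dX M g k x y := by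
  unfold dX
  rw [fderivWithin_congr (fun z hz => h z hz y hy) (h x hx y hy)]

lemma dY_congr (h : ∀ x ∈ M, ∀ y, y ≠ 0 → f x y = g x y) (k : Fin n) (hx : x ∈ M)
    (hy : y ≠ 0) : dY f k x y = dY g k x y := by
  unfold dY
  rw [Filter.EventuallyEq.fderiv_eq]
  filter_upwards [isOpen_ne_zero.mem_nhds hy] with z hz using h x hx z hz

lemma dirDeriv_comm (hM : RegularDomain M) (hf : SmoothTM M f) (v w : E n × E n) (hx : x ∈ M)
    (hy : y ≠ 0) :
    dirDeriv M (dirDeriv M f v) w x y = dirDeriv M (dirDeriv M f w) v x y := by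
  have hp : ((x, y) : E n × E n) ∈ slit M := ⟨hx, hy⟩
  have hs := ContDiffWithinAt.isSymmSndFDerivWithinAt (hf (x, y) hp)
    (by simp only [minSmoothness_of_isRCLikeNormedField]; exact WithTop.coe_le_coe.2 le_top)
    hM.uniqueDiffOn_slit (hM.slit_subset hp) hp
  have hd : DifferentiableWithinAt ℝ
      (fderivWithin ℝ (fun p : E n × E n => f p.1 p.2) (slit M)) (slit M) (x, y) :=
    ((ContDiffOn.fderivWithin hf hM.uniqueDiffOn_slit (m := ∞) (by simp)).differentiableOn
      (by simp)) _ hp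
  have key : ∀ v w : E n × E n, dirDeriv M (dirDeriv M f v) w x y =
      fderivWithin ℝ (fderivWithin ℝ (fun p : E n × E n => f p.1 p.2) (slit M)) (slit M)
        (x, y) w v := by
    intro v w
    have := fderivWithin_clm_apply (hM.uniqueDiffOn_slit _ hp) hd
      (differentiableWithinAt_const v)
    change fderivWithin ℝ (fun p : E n × E n =>
      (fderivWithin ℝ (fun p : E n × E n => f p.1 p.2) (slit M) p) v) (slit M) (x, y) w = _
    rw [this]
    simp
  rw [key, key]
  exact hs w v

lemma dX_dX_comm (hM : RegularDomain M) (hf : SmoothTM M f) (k l : Fin n) (hx : x ∈ M)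
    (hy : y ≠ 0) : dX M (dX M f k) l x y = dX M (dX M f l) k x y := by
  rw [dX_eq_dirDeriv hM (hf.dX hM k) l hx hy, dX_eq_dirDeriv hM (hf.dX hM l) k hx hy,
    dirDeriv_congr (fun _ hx _ hy => dX_eq_dirDeriv hM hf k hx hy) _ hx hy,
    dirDeriv_congr (fun _ hx _ hy => dX_eq_dirDeriv hM hf l hx hy) _ hx hy,
    dirDeriv_comm hM hf _ _ hx hy]

lemma dX_dY_comm (hM : RegularDomain M) (hf : SmoothTM M f) (k l : Fin n) (hx : x ∈ M)
    (hy : y ≠ 0) : dX M (dY f k) l x y = dY (dX M f l) k x y := by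
  rw [dX_eq_dirDeriv hM (hf.dY hM k) l hx hy, dY_eq_dirDeriv (hf.dX hM l) k hx hy,
    dirDeriv_congr (fun _ hx _ hy => dY_eq_dirDeriv hf k hx hy) _ hx hy,
    dirDeriv_congr (fun _ hx _ hy => dX_eq_dirDeriv hM hf l hx hy) _ hx hy,
    dirDeriv_comm hM hf _ _ hx hy]

lemma dY_dY_comm (hM : RegularDomain M) (hf : SmoothTM M f) (k l : Fin n) (hx : x ∈ M)
    (hy : y ≠ 0) : dY (dY f k) l x y = dY (dY f l) k x y := by
  rw [dY_eq_dirDeriv (hf.dY hM k) l hx hy, dY_eq_dirDeriv (hf.dY hM l) k hx hy,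
    dirDeriv_congr (fun _ hx _ hy => dY_eq_dirDeriv hf k hx hy) _ hx hy,
    dirDeriv_congr (fun _ hx _ hy => dY_eq_dirDeriv hf l hx hy) _ hx hy,
    dirDeriv_comm hM hf _ _ hx hy]

/-! ### Closure properties and the Leibniz rules -/

lemma SmoothTM.add (hf : SmoothTM M f) (hg : SmoothTM M g) :
    SmoothTM M fun x y => f x y + g x y := ContDiffOn.add hf hg

lemma SmoothTM.mul (hf : SmoothTM M f) (hg : SmoothTM M g) :
    SmoothTM M fun x y => f x y * g x y := ContDiffOn.mul hf hg

lemma SmoothTM.div (hf : SmoothTM M f) (hg : SmoothTM M g)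
    (h : ∀ x ∈ M, ∀ y, y ≠ 0 → g x y ≠ 0) :
    SmoothTM M fun x y => f x y / g x y := ContDiffOn.div hf hg fun p hp => h p.1 hp.1 p.2 hp.2

lemma SmoothTM.const (c : ℝ) : SmoothTM M fun _ _ => c := contDiffOn_const

lemma SmoothTM.sum {ι : Type*} {s : Finset ι} {f : ι → E n → E n → ℝ}
    (hf : ∀ i ∈ s, SmoothTM M (f i)) : SmoothTM M fun x y => ∑ i ∈ s, f i x y :=
  ContDiffOn.sum hf

lemma SmoothTM.snd_apply (i : Fin n) : SmoothTM M fun _ y => y i := by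
  have : ContDiff ℝ ∞ fun p : E n × E n => p.2 i := by fun_prop
  exact this.contDiffOn

lemma dX_mul (hM : RegularDomain M) (hf : SmoothTM M f) (hg : SmoothTM M g) (k : Fin n)
    (hx : x ∈ M) (hy : y ≠ 0) :
    dX M (fun x y => f x y * g x y) k x y = dX M f k x y * g x y + f x y * dX M g k x y := by
  unfold dX
  rw [fderivWithin_fun_mul (hM.uniqueDiffOn x hx) (hf.diffX hx hy) (hg.diffX hx hy)]
  simp
  ring

lemma dY_mul (hf : SmoothTM M f) (hg : SmoothTM M g) (k : Fin n)
    (hx : x ∈ M) (hy : y ≠ 0) :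
    dY (fun x y => f x y * g x y) k x y = dY f k x y * g x y + f x y * dY g k x y := by
  unfold dY
  rw [fderiv_fun_mul (hf.diffY hx hy) (hg.diffY hx hy)]
  simp
  ring

lemma dX_add (hM : RegularDomain M) (hf : SmoothTM M f) (hg : SmoothTM M g) (k : Fin n)
    (hx : x ∈ M) (hy : y ≠ 0) :
    dX M (fun x y => f x y + g x y) k x y = dX M f k x y + dX M g k x y := by
  unfold dX
  rw [fderivWithin_fun_add (hM.uniqueDiffOn x hx) (hf.diffX hx hy) (hg.diffX hx hy)]
  simp

lemma dY_add (hf : SmoothTM M f) (hg : SmoothTM M g) (k : Fin n) (hx : x ∈ M) (hy : y ≠ 0) :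
    dY (fun x y => f x y + g x y) k x y = dY f k x y + dY g k x y := by
  unfold dY
  rw [fderiv_fun_add (hf.diffY hx hy) (hg.diffY hx hy)]
  simp

lemma dY_sum {ι : Type*} {s : Finset ι} {f : ι → E n → E n → ℝ}
    (hf : ∀ i ∈ s, SmoothTM M (f i)) (k : Fin n) (hx : x ∈ M) (hy : y ≠ 0) :
    dY (fun x y => ∑ i ∈ s, f i x y) k x y = ∑ i ∈ s, dY (f i) k x y := by
  unfold dY
  rw [fderiv_fun_sum fun i hi => (hf i hi).diffY hx hy]
  simp

@[simp] lemma dY_const (c : ℝ) (k : Fin n) (x y : E n) :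
    dY (fun _ _ => c) k x y = 0 := by simp [dY]

lemma hasFDerivAt_apply (i : Fin n) (y : E n) :
    HasFDerivAt (fun y : E n => y i) (EuclideanSpace.proj i : E n →L[ℝ] ℝ) y :=
  (EuclideanSpace.proj i : E n →L[ℝ] ℝ).hasFDerivAt

@[simp] lemma dX_snd_apply (i k : Fin n) (x y : E n) :
    dX M (fun _ y => y i) k x y = 0 := by simp [dX]

@[simp] lemma dY_snd_apply (i k : Fin n) (x y : E n) :
    dY (fun _ y => y i) k x y = if i = k then 1 else 0 := by
  rw [dY, (hasFDerivAt_apply i y).fderiv]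
  simp

lemma dX_mul_snd_apply (hM : RegularDomain M) (hf : SmoothTM M f) (i k : Fin n)
    (hx : x ∈ M) (hy : y ≠ 0) :
    dX M (fun x y => f x y * y i) k x y = dX M f k x y * y i := by
  simp [dX_mul hM hf (SmoothTM.snd_apply i) k hx hy]

lemma dY_mul_snd_apply (hf : SmoothTM M f) (i k : Fin n) (hx : x ∈ M) (hy : y ≠ 0) :
    dY (fun x y => f x y * y i) k x y =
      dY f k x y * y i + f x y * if i = k then 1 else 0 := by
  simp [dY_mul hf (SmoothTM.snd_apply i) k hx hy]

/-! ### Homogeneity in the fibre variable -/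

/-- `f` is positively homogeneous of degree one in `y`. -/
def Homog (M : Set (E n)) (f : E n → E n → ℝ) : Prop :=
  ∀ x ∈ M, ∀ y, y ≠ 0 → ∀ t : ℝ, 0 < t → f x (t • y) = t * f x y

lemma Homog.dX (hM : RegularDomain M) (hf : Homog M f) (hs : SmoothTM M f) (k : Fin n) :
    Homog M (dX M f k) := by
  intro x hx y hy t ht
  have h : fderivWithin ℝ (fun x' => f x' (t • y)) M x =
      t • fderivWithin ℝ (fun x' => f x' y) M x := by
    rw [← fderivWithin_fun_const_smul (hM.uniqueDiffOn x hx) (hs.diffX hx hy) t]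
    exact fderivWithin_congr (fun z hz => hf z hz y hy t ht) (hf x hx y hy t ht)
  simp [SphFinsler.dX, h]

lemma sum_apply_mul_clm (L : E n →L[ℝ] ℝ) (y : E n) :
    ∑ k, y k * L (EuclideanSpace.single k 1) = L y := by
  conv_rhs => rw [← (EuclideanSpace.basisFun (Fin n) ℝ).sum_repr y]
  simp [map_sum]

/-- Euler's theorem. -/
lemma Homog.euler (hf : Homog M f) (hs : SmoothTM M f) (hx : x ∈ M) (hy : y ≠ 0) :
    ∑ k, y k * SphFinsler.dY f k x y = f x y := by
  simp only [SphFinsler.dY]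
  rw [sum_apply_mul_clm]
  have h1 : HasDerivAt (fun t : ℝ => f x (t • y)) (fderiv ℝ (fun y' => f x y') y y) 1 := by
    have h0 : HasDerivAt (fun t : ℝ => t • y) y 1 := by
      simpa using (hasDerivAt_id (1 : ℝ)).smul_const y
    have hd := (hs.diffY hx hy).hasFDerivAt
    rw [← one_smul ℝ y] at hd
    have := hd.comp_hasDerivAt (1 : ℝ) h0
    rwa [one_smul] at this
  have h2 : HasDerivAt (fun t : ℝ => f x (t • y)) (f x y) 1 := by
    have h0 : HasDerivAt (fun t : ℝ => t * f x y) (f x y) 1 := by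
      simpa using (hasDerivAt_id (1 : ℝ)).mul_const (f x y)
    refine h0.congr_of_eventuallyEq ?_
    filter_upwards [lt_mem_nhds (zero_lt_one' ℝ)] with t ht using hf x hx y hy t ht
  exact h1.unique h2

end SphFinsler
end

noncomputable section
namespace SphFinsler

variable {n : ℕ} {M : Set (E n)} {f F : E n → E n → ℝ} {x y : E n}

/-! ### Projectively flat Finsler metrics -/

lemma Homog.sum_dY_dY (hM : RegularDomain M) (hf : Homog M f) (hs : SmoothTM M f) (k : Fin n)
    (hx : x ∈ M) (hy : y ≠ 0) : ∑ j, y j * dY (dY f j) k x y = 0 := by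
  have h := dY_congr (f := fun x y => ∑ j, dY f j x y * y j) (g := f)
    (fun x hx y hy => by rw [← hf.euler hs hx hy]; simp_rw [mul_comm]) k hx hy
  rw [dY_sum (fun j _ => (hs.dY hM j).mul (SmoothTM.snd_apply j)) k hx hy] at h
  simp_rw [dY_mul_snd_apply (hs.dY hM _) _ k hx hy] at h
  rw [Finset.sum_add_distrib] at h
  simp only [mul_ite, mul_one, mul_zero, Finset.sum_ite_eq', Finset.mem_univ, if_true] at h
  simp_rw [mul_comm (y _)]
  linarith

lemma SmoothTM.sq (hs : SmoothTM M F) : SmoothTM M (sq F) :=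
  (hs.mul hs).congr fun x _ y _ => by rw [SphFinsler.sq]; ring

lemma dX_sq (hM : RegularDomain M) (hs : SmoothTM M F) (k : Fin n) (hx : x ∈ M) (hy : y ≠ 0) :
    dX M (sq F) k x y = 2 * (F x y * dX M F k x y) := by
  rw [dX_congr (g := fun x y => F x y * F x y) (fun x _ y _ => by rw [sq]; ring) k hx hy,
    dX_mul hM hs hs k hx hy]
  ring

lemma dY_sq (hs : SmoothTM M F) (k : Fin n) (hx : x ∈ M) (hy : y ≠ 0) :
    dY (sq F) k x y = 2 * (F x y * dY F k x y) := by
  rw [dY_congr (g := fun x y => F x y * F x y) (fun x _ y _ => by rw [sq]; ring) k hx hy,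
    dY_mul hs hs k hx hy]
  ring

lemma fundamentalTensor_apply (hM : RegularDomain M) (hs : SmoothTM M F) (i j : Fin n)
    (hx : x ∈ M) (hy : y ≠ 0) :
    fundamentalTensor F x y i j = dY F i x y * dY F j x y + F x y * dY (dY F i) j x y := by
  rw [fundamentalTensor, Matrix.of_apply,
    dY_congr (fun x hx y hy => dY_sq hs i hx hy) j hx hy,
    dY_mul (SmoothTM.const 2) (hs.mul (hs.dY hM i)) j hx hy, dY_const,
    dY_mul hs (hs.dY hM i) j hx hy]
  ring

/-- The projective factor `F_{xᵏ} yᵏ / (2 F)`. -/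
def projFactor (M : Set (E n)) (F : E n → E n → ℝ) : E n → E n → ℝ := fun x y =>
  (∑ k, dX M F k x y * y k) / (2 * F x y)

/-- Hamel's condition, in the form that `F_{xˡ yᵏ}` is symmetric in `k` and `l`. -/
def Hamel (M : Set (E n)) (F : E n → E n → ℝ) : Prop :=
  ∀ k l : Fin n, ∀ x ∈ M, ∀ y, y ≠ 0 → dX M (dY F k) l x y = dX M (dY F l) k x y

lemma IsFinslerMetric.smoothTM (hF : IsFinslerMetric M F) : SmoothTM M F := hF.smooth

lemma IsFinslerMetric.homog (hF : IsFinslerMetric M F) : Homog M F :=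
  fun x hx y _ t ht => hF.homogeneous x hx y t ht

lemma SmoothTM.projFactor (hM : RegularDomain M) (hF : IsFinslerMetric M F) :
    SmoothTM M (projFactor M F) :=
  (SmoothTM.sum fun k _ => (hF.smoothTM.dX hM k).mul (SmoothTM.snd_apply k)).div
    ((SmoothTM.const 2).mul hF.smoothTM)
    fun x hx y hy => mul_ne_zero two_ne_zero (hF.pos x hx y hy).ne'

lemma Homog.projFactor (hM : RegularDomain M) (hF : IsFinslerMetric M F) :
    Homog M (projFactor M F) := by
  intro x hx y hy t ht
  have h := (hF.pos x hx y hy).ne'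
  have hX := fun k => hF.homog.dX hM hF.smoothTM k x hx y hy t ht
  simp only [SphFinsler.projFactor, hX, hF.homogeneous x hx y t ht, PiLp.smul_apply, smul_eq_mul]
  have : ∑ k, t * SphFinsler.dX M F k x y * (t * y k) =
      t ^ 2 * ∑ k, SphFinsler.dX M F k x y * y k := by
    rw [Finset.mul_sum]
    exact Finset.sum_congr rfl fun k _ => by ring
  rw [this]
  field_simp

lemma sum_dX_mul_eq (hF : IsFinslerMetric M F) (hx : x ∈ M) (hy : y ≠ 0) :
    ∑ k, dX M F k x y * y k = 2 * (projFactor M F x y * F x y) := by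
  have h := (hF.pos x hx y hy).ne'
  rw [projFactor]
  field_simp

lemma Hamel.dY_dX (hH : Hamel M F) (hM : RegularDomain M) (hs : SmoothTM M F) (k l : Fin n)
    (hx : x ∈ M) (hy : y ≠ 0) : dY (dX M F k) l x y = dY (dX M F l) k x y := by
  rw [← dX_dY_comm hM hs l k hx hy, ← dX_dY_comm hM hs k l hx hy, hH l k x hx y hy]

lemma Hamel.sum_dY_dX (hH : Hamel M F) (hM : RegularDomain M) (hF : IsFinslerMetric M F)
    (l : Fin n) (hx : x ∈ M) (hy : y ≠ 0) :
    ∑ k, dY (dX M F k) l x y * y k = dX M F l x y := by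
  rw [← (hF.homog.dX hM hF.smoothTM l).euler (hF.smoothTM.dX hM l) hx hy]
  exact Finset.sum_congr rfl fun k _ => by rw [hH.dY_dX hM hF.smoothTM k l hx hy, mul_comm]

/-- `F_{xˡ} = (P F)_{yˡ}`. -/
lemma Hamel.dX_eq (hH : Hamel M F) (hM : RegularDomain M) (hF : IsFinslerMetric M F)
    (l : Fin n) (hx : x ∈ M) (hy : y ≠ 0) :
    dX M F l x y =
      dY (projFactor M F) l x y * F x y + projFactor M F x y * dY F l x y := by
  have hs := hF.smoothTM
  have hP := SmoothTM.projFactor hM hF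
  have h := dY_congr (fun x hx y hy => sum_dX_mul_eq hF hx hy) l hx hy
  rw [dY_sum (fun k _ => (hs.dX hM k).mul (SmoothTM.snd_apply k)) l hx hy,
    dY_mul (SmoothTM.const 2) (hP.mul hs) l hx hy, dY_const, dY_mul hP hs l hx hy] at h
  simp_rw [dY_mul_snd_apply (hs.dX hM _) _ l hx hy] at h
  rw [Finset.sum_add_distrib, hH.sum_dY_dX hM hF l hx hy] at h
  simp only [mul_ite, mul_one, mul_zero, Finset.sum_ite_eq', Finset.mem_univ, if_true] at h
  linarith

lemma fundamentalTensor_mulVec (hM : RegularDomain M) (hF : IsFinslerMetric M F) (hx : x ∈ M)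
    (hy : y ≠ 0) :
    (fundamentalTensor F x y).mulVec y.ofLp = fun i => F x y * dY F i x y := by
  ext i
  have hs := hF.smoothTM
  have h1 := hF.homog.sum_dY_dY hM hs i hx hy
  have h2 := hF.homog.euler hs hx hy
  calc ∑ j, fundamentalTensor F x y i j * y j
      = ∑ j, (dY F i x y * (y j * dY F j x y) + F x y * (y j * dY (dY F j) i x y)) := by
        refine Finset.sum_congr rfl fun j _ => ?_
        rw [fundamentalTensor_apply hM hs i j hx hy, dY_dY_comm hM hs i j hx hy]
        ring
    _ = _ := by
        rw [Finset.sum_add_distrib, ← Finset.mul_sum, ← Finset.mul_sum, h1, h2]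
        ring

/-- The geodesic coefficients of a projectively flat metric are `P yⁱ`. -/
lemma Hamel.geodesicCoeff_eq (hH : Hamel M F) (hM : RegularDomain M) (hF : IsFinslerMetric M F)
    (i : Fin n) (hx : x ∈ M) (hy : y ≠ 0) :
    geodesicCoeff M F i x y = projFactor M F x y * y i := by
  have hs := hF.smoothTM
  have key : ∀ l, (∑ k, dY (dX M (sq F) k) l x y * y k) - dX M (sq F) l x y =
      4 * projFactor M F x y * (F x y * dY F l x y) := by
    intro l
    have h1 : ∀ k, dY (dX M (sq F) k) l x y * y k =
        2 * dY F l x y * (dX M F k x y * y k) + 2 * F x y * (dY (dX M F k) l x y * y k) := by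
      intro k
      rw [dY_congr (fun x hx y hy => dX_sq hM hs k hx hy) l hx hy,
        dY_mul (SmoothTM.const 2) (hs.mul (hs.dX hM k)) l hx hy, dY_const,
        dY_mul hs (hs.dX hM k) l hx hy]
      ring
    simp_rw [h1]
    rw [Finset.sum_add_distrib, ← Finset.mul_sum, ← Finset.mul_sum, hH.sum_dY_dX hM hF l hx hy,
      sum_dX_mul_eq hF hx hy, dX_sq hM hs l hx hy]
    ring
  have hdet : IsUnit (fundamentalTensor F x y).det :=
    (hF.stronglyConvex x hx y hy).det_pos.ne'.isUnit
  have hinv : ((fundamentalTensor F x y)⁻¹).mulVec (fun l => F x y * dY F l x y) = y.ofLp := by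
    rw [← fundamentalTensor_mulVec hM hF hx hy, Matrix.mulVec_mulVec,
      Matrix.nonsing_inv_mul _ hdet, Matrix.one_mulVec]
  have hi := congrFun hinv i
  simp only [Matrix.mulVec, dotProduct] at hi
  rw [geodesicCoeff]
  simp_rw [key]
  have : ∑ l, (fundamentalTensor F x y)⁻¹ i l * (4 * projFactor M F x y * (F x y * dY F l x y)) =
      4 * projFactor M F x y *
        ∑ l, (fundamentalTensor F x y)⁻¹ i l * (F x y * dY F l x y) := by
    rw [Finset.mul_sum]
    exact Finset.sum_congr rfl fun l _ => by ring
  rw [this, hi]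
  ring

/-- A curve whose acceleration is proportional to its velocity is a straight line. -/
lemma collinear_image_of_hasDerivAt {V : Type*} [NormedAddCommGroup V] [InnerProductSpace ℝ V]
    {c v : ℝ → V} {l : ℝ → ℝ} {I : Set ℝ} (hI : IsOpen I) (hI' : I.OrdConnected)
    (hv : ∀ t ∈ I, v t ≠ 0) (hc : ∀ t ∈ I, HasDerivAt c (v t) t)
    (hv' : ∀ t ∈ I, HasDerivAt v (l t • v t) t) : Collinear ℝ (c '' I) := by
  rcases I.eq_empty_or_nonempty with rfl | ⟨t₀, ht₀⟩
  · simpa using collinear_empty ℝ V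
  have hpre : IsPreconnected I := hI'.isPreconnected
  have hdir : ∀ t ∈ I, HasDerivAt (fun t => ‖v t‖⁻¹ • v t) 0 t := by
    intro t ht
    have hn : ‖v t‖ ≠ 0 := norm_ne_zero_iff.2 (hv t ht)
    have h1 : HasDerivAt (fun t => ‖v t‖) (l t * ‖v t‖) t := by
      have h2 := (hv' t ht).norm_sq.sqrt (by positivity)
      simp only [Real.sqrt_sq (norm_nonneg _)] at h2
      convert h2 using 1
      rw [inner_smul_right, real_inner_self_eq_norm_sq]
      field_simp
    have h3 : HasDerivAt (fun t => ‖v t‖⁻¹ • v t) _ t := (h1.inv hn).smul (hv' t ht)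
    convert h3 using 1
    rw [smul_smul, ← add_smul]
    have : (‖v t‖⁻¹ * l t + -(l t * ‖v t‖) / ‖v t‖ ^ 2) = 0 := by field_simp; ring
    simp only [Pi.inv_apply]
    rw [this, zero_smul]
  set e := ‖v t₀‖⁻¹ • v t₀ with he
  have hve : ∀ t ∈ I, v t = ‖v t‖ • e := by
    intro t ht
    have h1 : ‖v t‖⁻¹ • v t = e := hI.is_const_of_deriv_eq_zero hpre
      (f := fun t => ‖v t‖⁻¹ • v t)
      (fun s hs => (hdir s hs).differentiableAt.differentiableWithinAt)
      (fun s hs => (hdir s hs).deriv) ht ht₀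
    rw [← h1, smul_smul, mul_inv_cancel₀ (norm_ne_zero_iff.2 (hv t ht)), one_smul]
  have hee : inner ℝ e e = (1 : ℝ) := by
    have : ‖v t₀‖ ≠ 0 := norm_ne_zero_iff.2 (hv t₀ ht₀)
    rw [he, inner_smul_left, inner_smul_right, real_inner_self_eq_norm_sq]
    simp
    field_simp
  have hcd : ∀ t ∈ I, HasDerivAt (fun t => c t - inner ℝ e (c t) • e) 0 t := by
    intro t ht
    have h1 : HasDerivAt (fun t => inner ℝ e (c t)) (inner ℝ e (v t)) t := by
      simpa using (hasDerivAt_const t e).inner ℝ (hc t ht)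
    have h2 : HasDerivAt (fun t => c t - inner ℝ e (c t) • e) _ t :=
      (hc t ht).sub (h1.smul_const e)
    convert h2 using 1
    rw [hve t ht, inner_smul_right, hee, mul_one, sub_self]
  rw [collinear_iff_exists_forall_eq_smul_vadd]
  refine ⟨c t₀ - inner ℝ e (c t₀) • e, e, ?_⟩
  rintro _ ⟨t, ht, rfl⟩
  refine ⟨inner ℝ e (c t), ?_⟩
  have h1 : c t - inner ℝ e (c t) • e = c t₀ - inner ℝ e (c t₀) • e :=
    hI.is_const_of_deriv_eq_zero hpre (f := fun t => c t - inner ℝ e (c t) • e)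
      (fun s hs => (hcd s hs).differentiableAt.differentiableWithinAt)
      (fun s hs => (hcd s hs).deriv) ht ht₀
  rw [← h1, vadd_eq_add]
  abel

theorem Hamel.isProjectivelyFlat (hH : Hamel M F) (hM : RegularDomain M)
    (hF : IsFinslerMetric M F) : IsProjectivelyFlat M F := by
  rintro c I hI hI' ⟨v, hv⟩
  refine collinear_image_of_hasDerivAt (v := v)
    (l := fun t => -2 * projFactor M F (c t) (v t)) hI hI' (fun t ht => (hv t ht).2.1)
    (fun t ht => (hv t ht).2.2.1) fun t ht => ?_
  obtain ⟨hcM, hv0, -, hd⟩ := hv t ht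
  have h : (-2 * projFactor M F (c t) (v t)) • v t =
      WithLp.toLp 2 fun i => -2 * geodesicCoeff M F i (c t) (v t) := by
    ext i
    simp [hH.geodesicCoeff_eq hM hF i hcM hv0]
    ring
  rwa [h]

end SphFinsler
end

noncomputable section
namespace SphFinsler

variable {n : ℕ} {M : Set (E n)} {f F : E n → E n → ℝ} {x y : E n}

/-! ### The curvature of projectively flat Finsler metrics -/

lemma Hamel.dY_dX_projFactor (hH : Hamel M F) (hM : RegularDomain M) (hF : IsFinslerMetric M F)
    (k l : Fin n) (hx : x ∈ M) (hy : y ≠ 0) :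
    dY (dX M (projFactor M F) l) k x y * F x y
        + dY (projFactor M F) k x y * projFactor M F x y * dY F l x y
        + dX M (projFactor M F) l x y * dY F k x y =
      dY (dX M (projFactor M F) k) l x y * F x y
        + dY (projFactor M F) l x y * projFactor M F x y * dY F k x y
        + dX M (projFactor M F) k x y * dY F l x y := by
  have hs := hF.smoothTM
  have hP := SmoothTM.projFactor hM hF
  have key : ∀ k l, dX M (dX M F k) l x y =
      dY (dX M (projFactor M F) l) k x y * F x y
        + dY (projFactor M F) k x y *
          (dY (projFactor M F) l x y * F x y + projFactor M F x y * dY F l x y)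
        + (dX M (projFactor M F) l x y * dY F k x y
        + projFactor M F x y * dX M (dY F k) l x y) := by
    intro k l
    rw [dX_congr (fun x hx y hy => hH.dX_eq hM hF k hx hy) l hx hy,
      dX_add hM ((hP.dY hM k).mul hs) (hP.mul (hs.dY hM k)) l hx hy,
      dX_mul hM (hP.dY hM k) hs l hx hy, dX_mul hM hP (hs.dY hM k) l hx hy,
      dX_dY_comm hM hP k l hx hy, hH.dX_eq hM hF l hx hy]
  have h := dX_dX_comm hM hs k l hx hy
  rw [key k l, key l k, hH k l x hx y hy] at h
  linarith

/-- `P² - P_{xᵏ} yᵏ`. -/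
def flatCurvature (M : Set (E n)) (F : E n → E n → ℝ) (x y : E n) : ℝ :=
  projFactor M F x y ^ 2 - ∑ l, y l * dX M (projFactor M F) l x y

lemma Hamel.flatCurvature_mul (hH : Hamel M F) (hM : RegularDomain M) (hF : IsFinslerMetric M F)
    (k : Fin n) (hx : x ∈ M) (hy : y ≠ 0) :
    flatCurvature M F x y * dY F k x y =
      F x y * (∑ l, y l * dY (dX M (projFactor M F) l) k x y
        + projFactor M F x y * dY (projFactor M F) k x y
        - 2 * dX M (projFactor M F) k x y) := by
  have hs := hF.smoothTM
  have hP := SmoothTM.projFactor hM hF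
  have hPh := Homog.projFactor hM hF
  have h1 := hF.homog.euler hs hx hy
  have h2 := hPh.euler hP hx hy
  have h3 := (hPh.dX hM hP k).euler (hP.dX hM k) hx hy
  have h : ∑ l, y l * (dY (dX M (projFactor M F) l) k x y * F x y
        + dY (projFactor M F) k x y * projFactor M F x y * dY F l x y
        + dX M (projFactor M F) l x y * dY F k x y) =
      ∑ l, y l * (dY (dX M (projFactor M F) k) l x y * F x y
        + dY (projFactor M F) l x y * projFactor M F x y * dY F k x y
        + dX M (projFactor M F) k x y * dY F l x y) :=
    Finset.sum_congr rfl fun l _ => by rw [hH.dY_dX_projFactor hM hF k l hx hy]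
  have e1 : ∑ l, y l * (dY (dX M (projFactor M F) l) k x y * F x y
        + dY (projFactor M F) k x y * projFactor M F x y * dY F l x y
        + dX M (projFactor M F) l x y * dY F k x y) =
      (∑ l, y l * dY (dX M (projFactor M F) l) k x y) * F x y
        + dY (projFactor M F) k x y * projFactor M F x y * (∑ l, y l * dY F l x y)
        + (∑ l, y l * dX M (projFactor M F) l x y) * dY F k x y := by
    simp only [Finset.sum_mul, Finset.mul_sum, ← Finset.sum_add_distrib]
    exact Finset.sum_congr rfl fun l _ => by ring
  have e2 : ∑ l, y l * (dY (dX M (projFactor M F) k) l x y * F x y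
        + dY (projFactor M F) l x y * projFactor M F x y * dY F k x y
        + dX M (projFactor M F) k x y * dY F l x y) =
      (∑ l, y l * dY (dX M (projFactor M F) k) l x y) * F x y
        + (∑ l, y l * dY (projFactor M F) l x y) * projFactor M F x y * dY F k x y
        + dX M (projFactor M F) k x y * (∑ l, y l * dY F l x y) := by
    simp only [Finset.sum_mul, Finset.mul_sum, ← Finset.sum_add_distrib]
    exact Finset.sum_congr rfl fun l _ => by ring
  rw [e1, e2, h1, h2, h3] at h
  rw [flatCurvature]
  linarith

lemma Hamel.riemannCurvature_eq (hH : Hamel M F) (hM : RegularDomain M)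
    (hF : IsFinslerMetric M F) (i k : Fin n) (hx : x ∈ M) (hy : y ≠ 0) :
    riemannCurvature M F i k x y = flatCurvature M F x y * (if i = k then 1 else 0)
      - y i * (flatCurvature M F x y * dY F k x y / F x y) := by
  have hs := hF.smoothTM
  have hP := SmoothTM.projFactor hM hF
  have hPh := Homog.projFactor hM hF
  have hG : ∀ i, ∀ x ∈ M, ∀ y, y ≠ 0 →
      geodesicCoeff M F i x y = projFactor M F x y * y i :=
    fun i x hx y hy => hH.geodesicCoeff_eq hM hF i hx hy
  have hGX : ∀ i j, ∀ x ∈ M, ∀ y, y ≠ 0 →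
      dX M (geodesicCoeff M F i) j x y = dX M (projFactor M F) j x y * y i := by
    intro i j x hx y hy
    rw [dX_congr (hG i) j hx hy, dX_mul_snd_apply hM hP i j hx hy]
  have hGY : ∀ i j, ∀ x ∈ M, ∀ y, y ≠ 0 → dY (geodesicCoeff M F i) j x y =
      dY (projFactor M F) j x y * y i + projFactor M F x y * (if i = j then 1 else 0) := by
    intro i j x hx y hy
    rw [dY_congr (hG i) j hx hy, dY_mul_snd_apply hP i j hx hy]
  have hGXY : ∀ i j k, dY (dX M (geodesicCoeff M F i) j) k x y =
      dY (dX M (projFactor M F) j) k x y * y i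
        + dX M (projFactor M F) j x y * (if i = k then 1 else 0) := by
    intro i j k
    rw [dY_congr (hGX i j) k hx hy, dY_mul_snd_apply (hP.dX hM j) i k hx hy]
  have hGYY : ∀ i j k, dY (dY (geodesicCoeff M F i) j) k x y =
      dY (dY (projFactor M F) j) k x y * y i
        + dY (projFactor M F) j x y * (if i = k then 1 else 0)
        + dY (projFactor M F) k x y * (if i = j then 1 else 0) := by
    intro i j k
    rw [dY_congr (hGY i j) k hx hy,
      dY_add ((hP.dY hM j).mul (SmoothTM.snd_apply i)) (hP.mul (SmoothTM.const _)) k hx hy,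
      dY_mul_snd_apply (hP.dY hM j) i k hx hy, dY_mul hP (SmoothTM.const _) k hx hy, dY_const]
    ring
  have h2 := hPh.euler hP hx hy
  have h4 := hPh.sum_dY_dY hM hP k hx hy
  have hFk := hH.flatCurvature_mul hM hF k hx hy
  have hF0 := (hF.pos x hx y hy).ne'
  have hdiv : flatCurvature M F x y * dY F k x y / F x y =
      ∑ l, y l * dY (dX M (projFactor M F) l) k x y
        + projFactor M F x y * dY (projFactor M F) k x y
        - 2 * dX M (projFactor M F) k x y := by
    rw [hFk]; field_simp
  rw [riemannCurvature, hdiv, hGX i k x hx y hy]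
  simp_rw [hGXY, hGYY, hG _ x hx y hy, hGY _ _ x hx y hy]
  set P := projFactor M F with hPdef
  have e1 : ∑ j, y j * (dY (dX M P j) k x y * y i + dX M P j x y * (if i = k then 1 else 0)) =
      (∑ j, y j * dY (dX M P j) k x y) * y i
        + (∑ j, y j * dX M P j x y) * (if i = k then 1 else 0) := by
    simp only [Finset.sum_mul, ← Finset.sum_add_distrib]
    exact Finset.sum_congr rfl fun l _ => by ring
  have e2 : ∑ j, P x y * y j * (dY (dY P j) k x y * y i
        + dY P j x y * (if i = k then 1 else 0) + dY P k x y * (if i = j then 1 else 0)) =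
      P x y * (∑ j, y j * dY (dY P j) k x y) * y i
        + P x y * (∑ j, y j * dY P j x y) * (if i = k then 1 else 0)
        + P x y * dY P k x y * y i := by
    have : P x y * dY P k x y * y i =
        ∑ j, P x y * dY P k x y * y j * (if i = j then 1 else 0) := by simp
    rw [this]
    simp only [Finset.sum_mul, Finset.mul_sum, ← Finset.sum_add_distrib]
    exact Finset.sum_congr rfl fun l _ => by ring
  have e3 : ∑ j, (dY P j x y * y i + P x y * (if i = j then 1 else 0)) *
        (dY P k x y * y j + P x y * (if j = k then 1 else 0)) =
      y i * dY P k x y * (∑ j, y j * dY P j x y) + P x y * dY P k x y * y i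
        + P x y * dY P k x y * y i + P x y ^ 2 * (if i = k then 1 else 0) := by
    have a1 : P x y * dY P k x y * y i =
        ∑ j, P x y * dY P j x y * y i * (if j = k then 1 else 0) := by simp
    have a2 : P x y * dY P k x y * y i =
        ∑ j, P x y * dY P k x y * y j * (if i = j then 1 else 0) := by simp
    have a3 : P x y ^ 2 * (if i = k then 1 else 0) =
        ∑ j, P x y ^ 2 * ((if i = j then 1 else 0) * (if j = k then 1 else 0)) := by simp
    nth_rewrite 1 [a1]
    rw [a2, a3]
    simp only [Finset.mul_sum, ← Finset.sum_add_distrib]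
    exact Finset.sum_congr rfl fun l _ => by ring
  rw [e1, e2, e3, h2, h4, flatCurvature]
  ring

lemma gForm_eq_dotProduct (F : E n → E n → ℝ) (x y u v : E n) :
    gForm F x y u v = u.ofLp ⬝ᵥ (fundamentalTensor F x y).mulVec v.ofLp := by
  simp only [gForm, dotProduct, Matrix.mulVec, Finset.mul_sum]
  exact Finset.sum_congr rfl fun i _ => Finset.sum_congr rfl fun j _ => by ring

/-- The strict Cauchy-Schwarz inequality for a positive definite matrix. -/
lemma _root_.Matrix.PosDef.sq_lt_of_linearIndependent {A : Matrix (Fin n) (Fin n) ℝ}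
    (hA : A.PosDef) {u v : Fin n → ℝ} (h : LinearIndependent ℝ ![u, v]) :
    (u ⬝ᵥ A.mulVec v) ^ 2 < (u ⬝ᵥ A.mulVec u) * (v ⬝ᵥ A.mulVec v) := by
  have hu : u ≠ 0 := h.ne_zero 0
  have hpu : 0 < u ⬝ᵥ A.mulVec u := by simpa using hA.dotProduct_mulVec_pos hu
  have hsymm : v ⬝ᵥ A.mulVec u = u ⬝ᵥ A.mulVec v := by
    rw [Matrix.dotProduct_mulVec, ← Matrix.mulVec_transpose, dotProduct_comm]
    congr 2
    simpa using hA.isHermitian.eq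
  set a := u ⬝ᵥ A.mulVec u
  set b := u ⬝ᵥ A.mulVec v
  have hw : a • v - b • u ≠ 0 := by
    intro h0
    have := LinearIndependent.pair_iff.1 h (-b) a (by rw [← h0, neg_smul]; abel)
    exact hpu.ne' this.2
  have hp : 0 < (a • v - b • u) ⬝ᵥ A.mulVec (a • v - b • u) := by
    simpa using hA.dotProduct_mulVec_pos hw
  have e : (a • v - b • u) ⬝ᵥ A.mulVec (a • v - b • u) =
      a * (a * (v ⬝ᵥ A.mulVec v) - b ^ 2) := by
    simp only [Matrix.mulVec_sub, Matrix.mulVec_smul, sub_dotProduct, dotProduct_sub,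
      smul_dotProduct, dotProduct_smul, smul_eq_mul, hsymm]
    change a * (a * _ - b * b) - b * (a * b - b * a) = _
    ring
  rw [e] at hp
  have := pos_of_mul_pos_right hp hpu.le
  linarith

theorem Hamel.hasScalarFlagCurvature (hH : Hamel M F) (hM : RegularDomain M)
    (hF : IsFinslerMetric M F) : HasScalarFlagCurvature M F := by
  refine ⟨fun x y => flatCurvature M F x y / F x y ^ 2, fun x hx y u hyu => ?_⟩
  have hy : y ≠ 0 := hyu.ne_zero 0
  have hF0 := (hF.pos x hx y hy).ne'
  have hpd := hF.stronglyConvex x hx y hy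
  have hli : LinearIndependent ℝ ![y.ofLp, u.ofLp] := by
    rw [LinearIndependent.pair_iff] at hyu ⊢
    intro s t hst
    exact hyu s t (by ext i; simpa using congrFun hst i)
  have hcs := hpd.sq_lt_of_linearIndependent hli
  have hR : (riemannMap M F x y u).ofLp = flatCurvature M F x y • u.ofLp
      - (flatCurvature M F x y / F x y * ∑ k, dY F k x y * u k) • y.ofLp := by
    ext i
    simp only [riemannMap, hH.riemannCurvature_eq hM hF i _ hx hy, Pi.sub_apply, Pi.smul_apply,
      smul_eq_mul, sub_mul, Finset.sum_sub_distrib]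
    congr 1
    · simp
    · rw [Finset.mul_sum, Finset.sum_mul]
      exact Finset.sum_congr rfl fun k _ => by ring
  have hmv := fundamentalTensor_mulVec hM hF hx hy
  have hsymm : ∀ v w : Fin n → ℝ, v ⬝ᵥ (fundamentalTensor F x y).mulVec w =
      w ⬝ᵥ (fundamentalTensor F x y).mulVec v := by
    intro v w
    rw [Matrix.dotProduct_mulVec, ← Matrix.mulVec_transpose, dotProduct_comm]
    congr 2
    simpa using hpd.isHermitian.eq
  have hyu' : y.ofLp ⬝ᵥ (fundamentalTensor F x y).mulVec u.ofLp =
      F x y * ∑ k, dY F k x y * u k := by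
    rw [hsymm, hmv, dotProduct, Finset.mul_sum]
    exact Finset.sum_congr rfl fun k _ => by ring
  have hyy : y.ofLp ⬝ᵥ (fundamentalTensor F x y).mulVec y.ofLp = F x y ^ 2 := by
    rw [hmv, dotProduct, pow_two]
    nth_rewrite 3 [← hF.homog.euler hF.smoothTM hx hy]
    rw [Finset.mul_sum]
    exact Finset.sum_congr rfl fun k _ => by ring
  rw [hyu', hyy] at hcs
  simp only [flagCurvature, gForm_eq_dotProduct]
  rw [hR, sub_dotProduct, smul_dotProduct, smul_dotProduct, hyu', hyy, smul_eq_mul, smul_eq_mul,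
    div_eq_div_iff (sub_pos.2 hcs).ne' (pow_ne_zero 2 hF0)]
  field_simp

end SphFinsler
end

noncomputable section
namespace SphFinsler

variable {n : ℕ} {M : Set (E n)} {f F : E n → E n → ℝ} {x y : E n}

/-! ### Symmetric domains -/

lemma RegularDomain.of_isOpen (hM : IsOpen M) : RegularDomain M :=
  ⟨hM.uniqueDiffOn, by rw [hM.interior_eq]; exact subset_closure⟩

lemma RegularDomain.of_convex
    (h : ∀ x ∈ M, ∃ C ⊆ M, IsOpen C ∧ Convex ℝ C ∧ x ∈ closure C) : RegularDomain M := by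
  constructor
  · intro x hx
    obtain ⟨C, hCM, hCo, hCc, hxC⟩ := h x hx
    refine (uniqueDiffWithinAt_convex hCc ?_ hxC).mono hCM
    rw [hCo.interior_eq]
    exact closure_nonempty_iff.1 ⟨x, hxC⟩
  · intro x hx
    obtain ⟨C, hCM, hCo, -, hxC⟩ := h x hx
    exact closure_mono (hCo.subset_interior_iff.2 hCM) hxC

lemma regularDomain_shell {ν₁ ν₂ : ℝ} (h₂ : 0 < ν₂) :
    RegularDomain {x : E n | ν₂ ≤ ‖x‖ ∧ ‖x‖ < ν₁} := by
  refine RegularDomain.of_convex fun x hx => ?_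
  have hx0 : 0 < ‖x‖ := h₂.trans_le hx.1
  refine ⟨{z | ‖x‖ ^ 2 < inner ℝ x z} ∩ Metric.ball 0 ν₁, ?_, ?_, ?_, ?_⟩
  · rintro z ⟨hz1, hz2⟩
    refine ⟨?_, by simpa using hz2⟩
    have h1 : ‖x‖ ^ 2 < ‖x‖ * ‖z‖ := lt_of_lt_of_le hz1 (real_inner_le_norm x z)
    have h2 : ‖x‖ < ‖z‖ := by nlinarith
    exact hx.1.trans h2.le
  · exact (isOpen_lt continuous_const (by fun_prop)).inter Metric.isOpen_ball
  · refine Convex.inter ?_ (convex_ball 0 ν₁)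
    exact convex_halfSpace_gt (innerSL ℝ x).toLinearMap.isLinear _
  · have hc : Filter.Tendsto (fun t : ℝ => t • x) (nhdsWithin 1 (Set.Ioi 1)) (nhds x) := by
      have : Continuous fun t : ℝ => t • x := by fun_prop
      simpa using (this.tendsto 1).mono_left nhdsWithin_le_nhds
    refine mem_closure_of_tendsto hc ?_
    have h3 : ∀ᶠ t : ℝ in nhdsWithin 1 (Set.Ioi 1), t • x ∈ Metric.ball (0 : E n) ν₁ :=
      hc.eventually (Metric.isOpen_ball.mem_nhds (by simpa using hx.2))
    filter_upwards [h3, self_mem_nhdsWithin] with t ht ht1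
    refine ⟨?_, ht⟩
    simp only [Set.mem_ofPred_eq, inner_smul_right, real_inner_self_eq_norm_sq]
    have : 0 < ‖x‖ ^ 2 := by positivity
    have ht1' : 1 < t := ht1
    nlinarith

lemma IsSymmetricDomain.regularDomain (hM : IsSymmetricDomain M) : RegularDomain M := by
  cases hM with
  | ball ν _ => exact RegularDomain.of_isOpen (isOpen_lt continuous_norm continuous_const)
  | shell ν₁ ν₂ h₂ h₁ =>
    rcases h₂.eq_or_lt with rfl | h₂
    · simpa using RegularDomain.of_isOpen
        (isOpen_lt (continuous_norm (E := E n)) (continuous_const (y := ν₁)))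
    · exact regularDomain_shell h₂
  | openShell ν₁ ν₂ h₂ h₁ =>
    exact RegularDomain.of_isOpen ((isOpen_lt continuous_const continuous_norm).inter
      (isOpen_lt continuous_norm continuous_const))
  | univ => exact RegularDomain.of_isOpen isOpen_univ

lemma IsSymmetricDomain.mem_of_norm_eq (hM : IsSymmetricDomain M) {z : E n} (hx : x ∈ M)
    (h : ‖z‖ = ‖x‖) : z ∈ M := by
  cases hM <;> simp_all

/-- The derivative of a radial function vanishes in directions orthogonal to `x`. -/
lemma IsSymmetricDomain.hasFDerivWithinAt_norm_comp_eq_zero (hM : IsSymmetricDomain M)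
    {h : ℝ → ℝ} {L : E n →L[ℝ] ℝ} (hx : x ∈ M) (hx0 : x ≠ 0)
    (hL : HasFDerivWithinAt (fun x : E n => h ‖x‖) L M x) {v : E n} (hv : inner ℝ x v = 0) :
    L v = 0 := by
  rcases eq_or_ne v 0 with rfl | hv0
  · simp
  have hnx : ‖x‖ ≠ 0 := norm_ne_zero_iff.2 hx0
  have hnv : ‖v‖ ≠ 0 := norm_ne_zero_iff.2 hv0
  let c : ℝ → E n := fun t => Real.cos t • x + (Real.sin t * (‖x‖ / ‖v‖)) • v
  have hc : ∀ t, ‖c t‖ = ‖x‖ := by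
    intro t
    rw [← sq_eq_sq₀ (norm_nonneg _) (norm_nonneg _)]
    simp only [c]
    rw [norm_add_sq_real, inner_smul_left, inner_smul_right, hv, norm_smul, norm_smul, mul_pow,
      mul_pow, Real.norm_eq_abs, Real.norm_eq_abs, sq_abs, sq_abs]
    have := Real.sin_sq_add_cos_sq t
    field_simp
    linear_combination ‖x‖ * ‖v‖ * this
  have hcd : HasDerivAt c ((‖x‖ / ‖v‖) • v) 0 := by
    have h1 := (Real.hasDerivAt_cos 0).smul_const x
    have h2 := ((Real.hasDerivAt_sin 0).mul_const (‖x‖ / ‖v‖)).smul_const v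
    exact HasDerivAt.congr_deriv (h1.add h2) (by simp)
  have hc0 : c 0 = x := by simp [c]
  have h1 : HasDerivAt (fun t => h ‖c t‖) (L ((‖x‖ / ‖v‖) • v)) 0 := by
    have := (hc0.symm ▸ hL : HasFDerivWithinAt (fun x : E n => h ‖x‖) L M (c 0)).comp_hasDerivAt
      (0 : ℝ) hcd (Filter.Eventually.of_forall fun t => hM.mem_of_norm_eq hx (hc t))
    exact this
  have h2 : HasDerivAt (fun t => h ‖c t‖) 0 0 := by
    simp only [hc]
    exact hasDerivAt_const _ _
  have h3 := h1.unique h2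
  rw [map_smul, smul_eq_mul] at h3
  exact (mul_eq_zero.1 h3).resolve_left (by positivity)

lemma IsSymmetricDomain.apply_mul_dX_comm (hM : IsSymmetricDomain M) {h : ℝ → ℝ}
    (hh : DifferentiableOn ℝ (fun x : E n => h ‖x‖) M) (hx : x ∈ M) (k l : Fin n) :
    x k * dX M (fun x _ => h ‖x‖) l x y = x l * dX M (fun x _ => h ‖x‖) k x y := by
  rcases eq_or_ne x 0 with rfl | hx0
  · simp
  have := hM.hasFDerivWithinAt_norm_comp_eq_zero hx hx0 (hh x hx).hasFDerivWithinAt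
    (v := x k • EuclideanSpace.single l 1 - x l • EuclideanSpace.single k 1)
    (by simp [inner_sub_right, inner_smul_right, EuclideanSpace.inner_single_right]; ring)
  rw [map_sub, map_smul, map_smul, smul_eq_mul, smul_eq_mul] at this
  exact sub_eq_zero.1 this

end SphFinsler
end

noncomputable section
namespace SphFinsler

variable {n : ℕ} {M : Set (E n)} {f F : E n → E n → ℝ} {x y : E n}

/-! ### Derivatives of spherically symmetric functions -/

lemma dX_eq_of_hasDerivAt (hM : RegularDomain M) {k : Fin n} {d : ℝ} (hx : x ∈ M)
    (hf : DifferentiableAt ℝ (fun x' => f x' y) x)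
    (h : HasDerivAt (fun t : ℝ => f (x + t • EuclideanSpace.single k 1) y) d 0) :
    dX M f k x y = d := by
  rw [dX, fderivWithin_eq_fderiv (hM.uniqueDiffOn x hx) hf]
  exact (hf.hasFDerivAt.hasLineDerivAt (EuclideanSpace.single k 1)).unique h

lemma dY_eq_of_hasDerivAt {k : Fin n} {d : ℝ}
    (hf : DifferentiableAt ℝ (fun y' => f x y') y)
    (h : HasDerivAt (fun t : ℝ => f x (y + t • EuclideanSpace.single k 1)) d 0) :
    dY f k x y = d :=
  (hf.hasFDerivAt.hasLineDerivAt (EuclideanSpace.single k 1)).unique h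

lemma dX_right (a : E n → ℝ) (k : Fin n) : dX M (fun _ y => a y) k x y = 0 := by simp [dX]

lemma dY_left (a : E n → ℝ) (k : Fin n) : dY (fun x _ => a x) k x y = 0 := by simp [dY]

/-- A total derivative along a curve in the plane, from the partial derivatives. -/
lemma hasDerivAt_comp₂ {g : ℝ → ℝ → ℝ} {a b : ℝ → ℝ} {a' b' gu gs t : ℝ}
    (hg : DifferentiableAt ℝ (fun p : ℝ × ℝ => g p.1 p.2) (a t, b t))
    (hgu : HasDerivAt (fun u => g u (b t)) gu (a t)) (hgs : HasDerivAt (g (a t)) gs (b t))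
    (ha : HasDerivAt a a' t) (hb : HasDerivAt b b' t) :
    HasDerivAt (fun t => g (a t) (b t)) (gu * a' + gs * b') t := by
  set L := fderiv ℝ (fun p : ℝ × ℝ => g p.1 p.2) (a t, b t)
  have hL : HasFDerivAt (fun p : ℝ × ℝ => g p.1 p.2) L (a t, b t) := hg.hasFDerivAt
  have h : HasDerivAt (fun t => g (a t) (b t)) (L (a', b')) t := by
    have := hL.comp_hasDerivAt t (ha.prodMk hb)
    exact this
  have h1 : HasDerivAt (fun u => g u (b t)) (L (1, 0)) (a t) := by
    have := hL.comp_hasDerivAt (a t)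
      ((hasDerivAt_id (a t)).prodMk (hasDerivAt_const (a t) (b t)))
    exact this
  have h2 : HasDerivAt (g (a t)) (L (0, 1)) (b t) := by
    have := hL.comp_hasDerivAt (b t)
      ((hasDerivAt_const (b t) (a t)).prodMk (hasDerivAt_id (b t)))
    exact this
  have e1 := h1.unique hgu
  have e2 := h2.unique hgs
  refine HasDerivAt.congr_deriv h ?_
  have e3 : ((a', b') : ℝ × ℝ) = a' • (1, 0) + b' • (0, 1) := by simp
  rw [e3, map_add, map_smul, map_smul, e1, e2, smul_eq_mul, smul_eq_mul]
  ring

lemma hasDerivAt_inner_line_right (x y : E n) (k : Fin n) :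
    HasDerivAt (fun t : ℝ => (inner ℝ x (y + t • EuclideanSpace.single k (1 : ℝ)) : ℝ))
      (x k) 0 := by
  have : HasDerivAt (fun t : ℝ => (inner ℝ x y : ℝ) + t * x k) (x k) 0 := by
    simpa using ((hasDerivAt_id (0 : ℝ)).mul_const (x k)).const_add (inner ℝ x y : ℝ)
  convert this using 2 with t
  simp [inner_add_right, inner_smul_right, EuclideanSpace.inner_single_right]

lemma hasDerivAt_inner_line_left (x y : E n) (k : Fin n) :
    HasDerivAt (fun t : ℝ => (inner ℝ (x + t • EuclideanSpace.single k (1 : ℝ)) y : ℝ))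
      (y k) 0 := by
  simpa only [real_inner_comm] using hasDerivAt_inner_line_right y x k

lemma hasDerivAt_norm_sq_line (y : E n) (k : Fin n) :
    HasDerivAt (fun t : ℝ => ‖y + t • EuclideanSpace.single k (1 : ℝ)‖ ^ 2) (2 * y k) 0 := by
  have h : HasDerivAt (fun t : ℝ => y + t • EuclideanSpace.single k (1 : ℝ))
      (EuclideanSpace.single k (1 : ℝ)) 0 := by
    simpa using ((hasDerivAt_id (0 : ℝ)).smul_const (EuclideanSpace.single k (1 : ℝ))).const_add y
  exact HasDerivAt.congr_deriv h.norm_sq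
    (by simp [EuclideanSpace.inner_single_right])

lemma hasDerivAt_norm_line (hy : y ≠ 0) (k : Fin n) :
    HasDerivAt (fun t : ℝ => ‖y + t • EuclideanSpace.single k (1 : ℝ)‖) (y k / ‖y‖) 0 := by
  have hn : ‖y‖ ≠ 0 := norm_ne_zero_iff.2 hy
  have h := (hasDerivAt_norm_sq_line y k).sqrt (by simpa using hy)
  simp only [Real.sqrt_sq (norm_nonneg _), zero_smul, add_zero] at h
  exact h.congr_deriv (by field_simp)

/-- The function of `x` and `y` given by a function of `|x|²` and `⟨x, y⟩ / |y|`. -/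
def lift (ψ : ℝ → ℝ → ℝ) (x y : E n) : ℝ := ψ (‖x‖ ^ 2) (inner ℝ x y / ‖y‖)

variable {ψ : ℝ → ℝ → ℝ}

lemma contDiffAt_lift (hψ : ContDiff ℝ ∞ fun p : ℝ × ℝ => ψ p.1 p.2) (hy : y ≠ 0) :
    ContDiffAt ℝ ∞ (fun p : E n × E n => lift ψ p.1 p.2) (x, y) := by
  have h1 : ContDiffAt ℝ ∞ (fun p : E n × E n => (inner ℝ p.1 p.2 : ℝ) / ‖p.2‖) (x, y) :=
    (contDiffAt_fst.inner ℝ contDiffAt_snd).div (contDiffAt_snd.norm ℝ hy)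
      (norm_ne_zero_iff.2 hy)
  exact hψ.contDiffAt.comp (x, y) ((contDiffAt_fst.norm_sq ℝ).prodMk h1)

lemma SmoothTM.lift (hψ : ContDiff ℝ ∞ fun p : ℝ × ℝ => ψ p.1 p.2) :
    SmoothTM M (lift ψ) :=
  fun p hp => (contDiffAt_lift (x := p.1) hψ hp.2).contDiffWithinAt

lemma SmoothTM.inner : SmoothTM M fun x y => (inner ℝ x y : ℝ) :=
  (contDiff_fst.inner ℝ contDiff_snd).contDiffOn

lemma SmoothTM.norm : SmoothTM M fun _ y => ‖y‖ :=
  contDiffOn_snd.norm ℝ fun _ hp => hp.2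

lemma SmoothTM.fst_apply (i : Fin n) : SmoothTM M fun x _ => x i := by
  have : ContDiff ℝ ∞ fun p : E n × E n => p.1 i := by fun_prop
  exact this.contDiffOn

lemma SmoothTM.left {a : E n → ℝ} (ha : ContDiffOn ℝ ∞ a M) : SmoothTM M fun x _ => a x :=
  ha.comp contDiffOn_fst fun _ hp => hp.1

lemma dX_lift (hM : RegularDomain M) (hψ : ContDiff ℝ ∞ fun p : ℝ × ℝ => ψ p.1 p.2)
    {u s ψu ψs : ℝ} (hu : u = ‖x‖ ^ 2) (hs : s = inner ℝ x y / ‖y‖)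
    (h1 : HasDerivAt (fun u => ψ u s) ψu u) (h2 : HasDerivAt (ψ u) ψs s)
    (k : Fin n) (hx : x ∈ M) (hy : y ≠ 0) :
    dX M (lift ψ) k x y = ψu * (2 * x k) + ψs * (y k / ‖y‖) := by
  subst hu hs
  refine dX_eq_of_hasDerivAt hM hx ?_ ?_
  · exact ((SmoothTM.lift hψ).diffX (Set.mem_univ x) hy).differentiableAt Filter.univ_mem
  · refine hasDerivAt_comp₂ (a := fun t => ‖x + t • EuclideanSpace.single k (1 : ℝ)‖ ^ 2)
      (b := fun t => (inner ℝ (x + t • EuclideanSpace.single k (1 : ℝ)) y : ℝ) / ‖y‖)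
      (hψ.differentiable (by simp) _) ?_ ?_ (hasDerivAt_norm_sq_line x k)
      ((hasDerivAt_inner_line_left x y k).div_const _)
    · simpa using h1
    · simpa using h2

lemma dY_lift (hψ : ContDiff ℝ ∞ fun p : ℝ × ℝ => ψ p.1 p.2)
    {u s ψs : ℝ} (hu : u = ‖x‖ ^ 2) (hs : s = inner ℝ x y / ‖y‖) (h2 : HasDerivAt (ψ u) ψs s)
    (k : Fin n) (hy : y ≠ 0) :
    dY (lift ψ) k x y = ψs * ((x k - s * (y k / ‖y‖)) / ‖y‖) := by
  subst hu
  have hn : ‖y‖ ≠ 0 := norm_ne_zero_iff.2 hy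
  refine dY_eq_of_hasDerivAt ?_ ?_
  · exact (SmoothTM.lift hψ).diffY (Set.mem_univ x) hy
  · have h3 := (hasDerivAt_inner_line_right x y k).div (hasDerivAt_norm_line hy k)
      (by simpa using hy)
    have h4 : HasDerivAt (ψ (‖x‖ ^ 2)) ψs
        ((inner ℝ x (y + (0 : ℝ) • EuclideanSpace.single k (1 : ℝ)) : ℝ) /
          ‖y + (0 : ℝ) • EuclideanSpace.single k (1 : ℝ)‖) := by
      simpa [← hs] using h2
    refine (h4.comp (0 : ℝ) h3).congr_deriv ?_
    simp only [zero_smul, add_zero]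
    rw [hs]
    field_simp

lemma dY_inner (k : Fin n) : dY (fun x y : E n => (inner ℝ x y : ℝ)) k x y = x k :=
  dY_eq_of_hasDerivAt ((innerSL ℝ x).differentiableAt) (hasDerivAt_inner_line_right x y k)

lemma dY_norm (hy : y ≠ 0) (k : Fin n) : dY (fun _ y : E n => ‖y‖) k x y = y k / ‖y‖ :=
  dY_eq_of_hasDerivAt ((contDiffAt_norm (n := 1) ℝ hy).differentiableAt (by simp))
    (hasDerivAt_norm_line hy k)

lemma dX_fst_apply (hM : RegularDomain M) (hx : x ∈ M) (i k : Fin n) :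
    dX M (fun x _ => x i) k x y = if i = k then 1 else 0 := by
  rw [dX, ((hasFDerivAt_apply i x).hasFDerivWithinAt).fderivWithin (hM.uniqueDiffOn x hx)]
  simp

lemma dY_apply_div_norm (hx : x ∈ M) (hy : y ≠ 0) (i k : Fin n) :
    dY (fun _ y : E n => y i / ‖y‖) k x y =
      (if i = k then 1 else 0) / ‖y‖ - y i * y k / ‖y‖ ^ 3 := by
  have hn : ‖y‖ ≠ 0 := norm_ne_zero_iff.2 hy
  have hs : SmoothTM M fun _ y => y i / ‖y‖ :=
    (SmoothTM.snd_apply i).div SmoothTM.norm fun x _ y hy => norm_ne_zero_iff.2 hy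
  have h := dY_congr (M := M) (f := fun _ y : E n => y i / ‖y‖ * ‖y‖) (g := fun _ y => y i)
    (fun x _ y hy => div_mul_cancel₀ _ (norm_ne_zero_iff.2 hy)) k hx hy
  rw [dY_mul hs SmoothTM.norm k hx hy, dY_norm hy, dY_snd_apply] at h
  field_simp at h ⊢
  linear_combination h

end SphFinsler
end

noncomputable section
namespace SphFinsler

variable {n : ℕ} {M : Set (E n)} {f F : E n → E n → ℝ} {x y : E n}

/-! ### Spherically symmetric metrics satisfying Hamel's condition -/

/-- `ψ(u, s)`, as a function of `u = r²` and `s`, satisfies `ψ_ss = 2 (ψ - s ψ_s)_u`; here `A` is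
`ψ - s ψ_s`, `B` is `ψ_s`, and `C` is the derivative of `A` in `u`. -/
structure IsFlatPotential (ψ A B C : ℝ → ℝ → ℝ) : Prop where
  smooth : ContDiff ℝ ∞ fun p : ℝ × ℝ => ψ p.1 p.2
  smooth_left : ContDiff ℝ ∞ fun p : ℝ × ℝ => A p.1 p.2
  smooth_deriv : ContDiff ℝ ∞ fun p : ℝ × ℝ => B p.1 p.2
  eq_add (u s : ℝ) : ψ u s = A u s + s * B u s
  hasDerivAt (u s : ℝ) : HasDerivAt (ψ u) (B u s) s
  hasDerivAt_deriv (u s : ℝ) : HasDerivAt (B u) (2 * C u s) s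
  hasDerivAt_left (u s : ℝ) : HasDerivAt (fun u => A u s) (C u s) u

/-- The metric `⟨x, y⟩ h(|x|) + |y| ψ(|x|², ⟨x, y⟩ / |y|)`. -/
def potentialMetric (h : ℝ → ℝ) (ψ : ℝ → ℝ → ℝ) (x y : E n) : ℝ :=
  inner ℝ x y * h ‖x‖ + ‖y‖ * lift ψ x y

variable {h : ℝ → ℝ} {ψ A B C : ℝ → ℝ → ℝ}

lemma IsFlatPotential.hasDerivAt_left_right (hψ : IsFlatPotential ψ A B C) (u s : ℝ) :
    HasDerivAt (A u) (-s * (2 * C u s)) s := by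
  have h1 := (hψ.hasDerivAt u s).sub ((hasDerivAt_id s).mul (hψ.hasDerivAt_deriv u s))
  have e : A u = ψ u - id * B u := by
    ext s
    simp [hψ.eq_add u s]
  rw [e]
  exact h1.congr_deriv (by simp)

lemma smoothTM_potentialMetric (hh : ContDiffOn ℝ ∞ (fun x : E n => h ‖x‖) M)
    (hψ : IsFlatPotential ψ A B C) : SmoothTM M (potentialMetric (n := n) h ψ) :=
  (SmoothTM.inner.mul (SmoothTM.left hh)).add (SmoothTM.norm.mul (SmoothTM.lift hψ.smooth))

lemma SmoothTM.apply_div_norm (k : Fin n) : SmoothTM M fun _ y => y k / ‖y‖ :=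
  (SmoothTM.snd_apply k).div SmoothTM.norm fun _ _ _ hy => norm_ne_zero_iff.2 hy

lemma dY_potentialMetric (hh : ContDiffOn ℝ ∞ (fun x : E n => h ‖x‖) M)
    (hψ : IsFlatPotential ψ A B C) (k : Fin n) (hx : x ∈ M) (hy : y ≠ 0) :
    dY (potentialMetric h ψ) k x y =
      x k * (h ‖x‖ + lift B x y) + y k / ‖y‖ * lift A x y := by
  have hn : ‖y‖ ≠ 0 := norm_ne_zero_iff.2 hy
  have e : lift ψ x y = lift A x y + inner ℝ x y / ‖y‖ * lift B x y := hψ.eq_add _ _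
  unfold potentialMetric
  rw [dY_add (SmoothTM.inner.mul (SmoothTM.left hh)) (SmoothTM.norm.mul (SmoothTM.lift hψ.smooth))
      k hx hy, dY_mul SmoothTM.inner (SmoothTM.left hh) k hx hy,
    dY_mul SmoothTM.norm (SmoothTM.lift hψ.smooth) k hx hy, dY_inner, dY_left, dY_norm hy,
    dY_lift hψ.smooth rfl rfl (hψ.hasDerivAt _ _) k hy, e,
    show B (‖x‖ ^ 2) (inner ℝ x y / ‖y‖) = lift B x y from rfl]
  field_simp
  ring

lemma hamel_potentialMetric (hM : IsSymmetricDomain M)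
    (hh : ContDiffOn ℝ ∞ (fun x : E n => h ‖x‖) M) (hψ : IsFlatPotential ψ A B C) :
    Hamel M (potentialMetric (n := n) h ψ) := by
  have hR := hM.regularDomain
  have key : ∀ k l : Fin n, ∀ x ∈ M, ∀ y, y ≠ 0 →
      dX M (dY (potentialMetric h ψ) k) l x y =
        (if k = l then 1 else 0) * (h ‖x‖ + lift B x y)
          + x k * (dX M (fun x _ => h ‖x‖) l x y + dX M (lift B) l x y)
          + y k / ‖y‖ * dX M (lift A) l x y := by
    intro k l x hx y hy
    have hHB : SmoothTM M fun x y : E n => h ‖x‖ + lift B x y :=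
      (SmoothTM.left hh).add (SmoothTM.lift hψ.smooth_deriv)
    rw [dX_congr (fun x hx y hy => dY_potentialMetric hh hψ k hx hy) l hx hy,
      dX_add hR ((SmoothTM.fst_apply k).mul hHB)
        ((SmoothTM.apply_div_norm k).mul (SmoothTM.lift hψ.smooth_left)) l hx hy,
      dX_mul hR (SmoothTM.fst_apply k) hHB l hx hy,
      dX_mul hR (SmoothTM.apply_div_norm k) (SmoothTM.lift hψ.smooth_left) l hx hy,
      dX_add hR (SmoothTM.left hh) (SmoothTM.lift hψ.smooth_deriv) l hx hy,
      dX_fst_apply hR hx, dX_right fun y : E n => y k / ‖y‖]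
    ring
  intro k l x hx y hy
  have hBu : DifferentiableAt ℝ (fun u => B u (inner ℝ x y / ‖y‖)) (‖x‖ ^ 2) := by
    have : ContDiff ℝ ∞ fun u => B u (inner ℝ x y / ‖y‖) :=
      hψ.smooth_deriv.comp (contDiff_id.prodMk contDiff_const)
    exact this.differentiable (by simp) _
  have hH := hM.apply_mul_dX_comm (y := y) (hh.differentiableOn (by simp)) hx k l
  rw [key k l x hx y hy, key l k x hx y hy]
  simp only [dX_lift hR hψ.smooth_deriv rfl rfl hBu.hasDerivAt (hψ.hasDerivAt_deriv _ _) _ hx hy,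
    dX_lift hR hψ.smooth_left rfl rfl (hψ.hasDerivAt_left _ _) (hψ.hasDerivAt_left_right _ _) _
      hx hy]
  simp only [eq_comm (a := l) (b := k)]
  linear_combination hH

lemma dY_dY_potentialMetric (hh : ContDiffOn ℝ ∞ (fun x : E n => h ‖x‖) M)
    (hψ : IsFlatPotential ψ A B C) (k l : Fin n) (hx : x ∈ M) (hy : y ≠ 0) :
    dY (dY (potentialMetric h ψ) k) l x y =
      2 * lift C x y / ‖y‖ * (x k - inner ℝ x y / ‖y‖ * (y k / ‖y‖)) *
          (x l - inner ℝ x y / ‖y‖ * (y l / ‖y‖))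
        + lift A x y * ((if k = l then 1 else 0) / ‖y‖ - y k * y l / ‖y‖ ^ 3) := by
  have hHB : SmoothTM M fun x y : E n => h ‖x‖ + lift B x y :=
    (SmoothTM.left hh).add (SmoothTM.lift hψ.smooth_deriv)
  rw [dY_congr (fun x hx y hy => dY_potentialMetric hh hψ k hx hy) l hx hy,
    dY_add ((SmoothTM.fst_apply k).mul hHB)
      ((SmoothTM.apply_div_norm k).mul (SmoothTM.lift hψ.smooth_left)) l hx hy,
    dY_mul (SmoothTM.fst_apply k) hHB l hx hy,
    dY_mul (SmoothTM.apply_div_norm k) (SmoothTM.lift hψ.smooth_left) l hx hy,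
    dY_add (SmoothTM.left hh) (SmoothTM.lift hψ.smooth_deriv) l hx hy,
    dY_left fun x : E n => x k, dY_left fun x : E n => h ‖x‖, dY_apply_div_norm hx hy,
    dY_lift hψ.smooth_deriv rfl rfl (hψ.hasDerivAt_deriv _ _) l hy,
    dY_lift hψ.smooth_left rfl rfl (hψ.hasDerivAt_left_right _ _) l hy]
  simp only [← lift.eq_1]
  have hn : ‖y‖ ≠ 0 := norm_ne_zero_iff.2 hy
  field_simp
  ring

lemma abs_inner_div_norm_le (x y : E n) : |inner ℝ x y / ‖y‖| ≤ ‖x‖ := by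
  rw [abs_div, abs_norm]
  exact div_le_of_le_mul₀ (norm_nonneg _) (norm_nonneg _) (abs_real_inner_le_norm x y)

lemma posDef_fundamentalTensor (hM : RegularDomain M)
    (hh : ContDiffOn ℝ ∞ (fun x : E n => h ‖x‖) M) (hψ : IsFlatPotential ψ A B C)
    (hhom : Homog M (potentialMetric (n := n) h ψ)) (hx : x ∈ M) (hy : y ≠ 0)
    (hpos : 0 < potentialMetric h ψ x y) (hA : 0 < lift A x y) (hC : 0 ≤ lift C x y) :
    (fundamentalTensor (potentialMetric h ψ) x y).PosDef := by
  have hs := smoothTM_potentialMetric hh hψ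
  set F := potentialMetric (n := n) h ψ with hF
  refine Matrix.PosDef.of_dotProduct_mulVec_pos ?_ fun v hv => ?_
  · ext i j
    simp only [Matrix.conjTranspose_apply, star_trivial, fundamentalTensor_apply hM hs _ _ hx hy,
      dY_dY_comm hM hs j i hx hy]
    ring
  have hyn : 0 < ‖y‖ := norm_pos_iff.2 hy
  set w : E n := WithLp.toLp 2 v with hw
  have hw0 : w ≠ 0 := fun h0 => hv (by simpa [hw] using h0)
  have hvw : ∀ i, v i = w i := fun _ => rfl
  have hquad : star v ⬝ᵥ (fundamentalTensor F x y).mulVec v = (∑ k, w k * dY F k x y) ^ 2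
      + F x y * (2 * lift C x y / ‖y‖ *
          (∑ k, w k * (x k - inner ℝ x y / ‖y‖ * (y k / ‖y‖))) ^ 2
        + lift A x y * (‖w‖ ^ 2 / ‖y‖ - inner ℝ y w ^ 2 / ‖y‖ ^ 3)) := by
    have e1 : ‖w‖ ^ 2 = ∑ k, ∑ l, w k * w l * (if k = l then 1 else 0) := by
      simp [EuclideanSpace.real_norm_sq_eq, pow_two (w _)]
    have e2 : inner ℝ y w = ∑ k, w k * y k := by
      simp [PiLp.inner_apply]
    have e3 (a : Fin n → ℝ) : (∑ k, a k) ^ 2 = ∑ k, ∑ l, a k * a l := by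
      rw [pow_two, Finset.sum_mul_sum]
    have e4 : star v ⬝ᵥ (fundamentalTensor F x y).mulVec v =
        ∑ k, ∑ l, w k * (fundamentalTensor F x y k l * w l) := by
      simp only [dotProduct, Matrix.mulVec, star_trivial, Finset.mul_sum, hvw]
    have e5 (k l : Fin n) : fundamentalTensor F x y k l = dY F k x y * dY F l x y + F x y * _ :=
      (fundamentalTensor_apply hM hs k l hx hy).trans
        (by rw [hF, dY_dY_potentialMetric hh hψ k l hx hy])
    rw [e1, e2, e3, e3, e3, e4]
    simp only [e5, Finset.mul_sum, Finset.sum_div, ← Finset.sum_add_distrib,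
      ← Finset.sum_sub_distrib]
    exact Finset.sum_congr rfl fun k _ => Finset.sum_congr rfl fun l _ => by ring
  rw [hquad]
  have hcs : (inner ℝ y w : ℝ) ^ 2 ≤ (‖y‖ * ‖w‖) ^ 2 :=
    sq_le_sq.2 (by rw [abs_of_nonneg (by positivity : 0 ≤ ‖y‖ * ‖w‖)]
                   exact abs_real_inner_le_norm y w)
  have hc0 : 0 ≤ 2 * lift C x y / ‖y‖ *
      (∑ k, w k * (x k - inner ℝ x y / ‖y‖ * (y k / ‖y‖))) ^ 2 := by positivity
  have e3 : ‖w‖ ^ 2 / ‖y‖ - inner ℝ y w ^ 2 / ‖y‖ ^ 3 =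
      ((‖y‖ * ‖w‖) ^ 2 - inner ℝ y w ^ 2) / ‖y‖ ^ 3 := by field_simp
  rw [e3]
  rcases hcs.lt_or_eq with hlt | heq
  · have : 0 < lift A x y * (((‖y‖ * ‖w‖) ^ 2 - inner ℝ y w ^ 2) / ‖y‖ ^ 3) :=
      mul_pos hA (div_pos (sub_pos.2 hlt) (by positivity))
    have := mul_pos hpos (add_pos_of_nonneg_of_pos hc0 this)
    positivity
  · have hn : ‖(inner ℝ y w : ℝ)‖ = ‖y‖ * ‖w‖ := by
      rw [Real.norm_eq_abs, ← abs_of_nonneg (by positivity : 0 ≤ ‖y‖ * ‖w‖)]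
      exact (sq_eq_sq_iff_abs_eq_abs _ _).1 heq
    obtain ⟨r, hr, hwr⟩ := (norm_inner_eq_norm_iff hy hw0).1 hn
    have h1 : ∑ k, w k * dY F k x y = r * F x y := by
      rw [← hhom.euler hs hx hy, Finset.mul_sum]
      exact Finset.sum_congr rfl fun k _ => by rw [hwr]; simp; ring
    rw [heq, sub_self, zero_div, mul_zero, add_zero, h1]
    have : 0 < (r * F x y) ^ 2 := by
      have := hpos.ne'
      positivity
    have := mul_nonneg hpos.le hc0
    linarith

lemma sphericalMetric_eq_potentialMetric (hy : y ≠ 0) :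
    sphericalMetric (fun r s => s * h r + ψ (r ^ 2) s) x y = potentialMetric h ψ x y := by
  have hn : ‖y‖ ≠ 0 := norm_ne_zero_iff.2 hy
  rw [sphericalMetric, potentialMetric, lift]
  field_simp

lemma sphericalMetric_zero_right (φ : ℝ → ℝ → ℝ) (x : E n) : sphericalMetric φ x 0 = 0 := by
  simp [sphericalMetric]

lemma sphericalMetric_smul (φ : ℝ → ℝ → ℝ) (x y : E n) {t : ℝ} (ht : 0 < t) :
    sphericalMetric φ x (t • y) = t * sphericalMetric φ x y := by
  rw [sphericalMetric, sphericalMetric, norm_smul, Real.norm_of_nonneg ht.le, inner_smul_right,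
    mul_div_mul_left _ _ ht.ne']
  ring

lemma fundamentalTensor_congr {G : E n → E n → ℝ}
    (h : ∀ x ∈ M, ∀ y, y ≠ 0 → F x y = G x y) (hx : x ∈ M) (hy : y ≠ 0) :
    fundamentalTensor F x y = fundamentalTensor G x y := by
  have h1 : ∀ x ∈ M, ∀ y, y ≠ 0 → sq F x y = sq G x y :=
    fun x hx y hy => by rw [sq, sq, h x hx y hy]
  ext i j
  rw [fundamentalTensor, fundamentalTensor, Matrix.of_apply, Matrix.of_apply,
    dY_congr (fun x hx y hy => dY_congr h1 i hx hy) j hx hy]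

lemma Hamel.congr {G : E n → E n → ℝ} (hH : Hamel M F)
    (h : ∀ x ∈ M, ∀ y, y ≠ 0 → G x y = F x y) : Hamel M G := by
  intro k l x hx y hy
  rw [dX_congr (fun x hx y hy => dY_congr h k hx hy) l hx hy,
    dX_congr (fun x hx y hy => dY_congr h l hx hy) k hx hy]
  exact hH k l x hx y hy

theorem sphericalMetric_of_isFlatPotential (hM : IsSymmetricDomain M)
    (hh : ContDiffOn ℝ ∞ (fun x : E n => h ‖x‖) M) (hψ : IsFlatPotential ψ A B C)
    (hA : ∀ u s, s ^ 2 ≤ u → 0 < A u s) (hC : ∀ u s, s ^ 2 ≤ u → 0 ≤ C u s)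
    {φ : ℝ → ℝ → ℝ} (hφ : ∀ r s, φ r s = s * h r + ψ (r ^ 2) s)
    (hpos : ∀ x ∈ M, ∀ s : ℝ, |s| ≤ ‖x‖ → 0 < φ ‖x‖ s) :
    IsFinslerMetric M (sphericalMetric φ) ∧ IsProjectivelyFlat M (sphericalMetric φ) ∧
      HasScalarFlagCurvature M (sphericalMetric φ) := by
  obtain rfl : φ = fun r s => s * h r + ψ (r ^ 2) s := by ext r s; exact hφ r s
  have hR := hM.regularDomain
  have heq : ∀ x ∈ M, ∀ y : E n, y ≠ 0 →
      sphericalMetric (fun r s => s * h r + ψ (r ^ 2) s) x y = potentialMetric h ψ x y :=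
    fun x _ y hy => sphericalMetric_eq_potentialMetric hy
  have hp : ∀ x ∈ M, ∀ y : E n, y ≠ 0 →
      0 < sphericalMetric (fun r s => s * h r + ψ (r ^ 2) s) x y := fun x hx y hy =>
    mul_pos (norm_pos_iff.2 hy) (hpos x hx _ (abs_inner_div_norm_le x y))
  have hhom : Homog M (potentialMetric (n := n) h ψ) := by
    intro x hx y hy t ht
    rw [← heq x hx y hy, ← heq x hx _ (smul_ne_zero ht.ne' hy), sphericalMetric_smul _ _ _ ht]
  have hF : IsFinslerMetric M (sphericalMetric (n := n) fun r s => s * h r + ψ (r ^ 2) s) := by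
    refine ⟨(smoothTM_potentialMetric hh hψ).congr heq, fun x _ => sphericalMetric_zero_right _ x,
      hp, fun x _ y t ht => sphericalMetric_smul _ x y ht, fun x hx y hy => ?_⟩
    have hs : (inner ℝ x y / ‖y‖ : ℝ) ^ 2 ≤ ‖x‖ ^ 2 :=
      sq_le_sq.2 (by rw [abs_norm]; exact abs_inner_div_norm_le x y)
    rw [fundamentalTensor_congr heq hx hy]
    exact posDef_fundamentalTensor hR hh hψ hhom hx hy (heq x hx y hy ▸ hp x hx y hy)
      (hA _ _ hs) (hC _ _ hs)
  have hH := (hamel_potentialMetric hM hh hψ).congr heq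
  exact ⟨hF, hH.isProjectivelyFlat hR hF, hH.hasScalarFlagCurvature hR hF⟩

end SphFinsler
end

noncomputable section
namespace SphFinsler

/-! ### The family `φ_m` -/

lemma contDiff_of_hasDerivAt {f g : ℝ → ℝ} (h : ∀ s, HasDerivAt f (g s) s)
    (hg : ContDiff ℝ ∞ g) : ContDiff ℝ ∞ f := by
  rw [contDiff_infty_iff_deriv]
  refine ⟨fun s => (h s).differentiableAt, ?_⟩
  rwa [show deriv f = g from funext fun s => (h s).deriv]

lemma hasDerivAt_primitive {g : ℝ → ℝ} (hg : Continuous g) (s : ℝ) :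
    HasDerivAt (fun s => ∫ t in (0 : ℝ)..s, g t) (g s) s :=
  intervalIntegral.integral_hasDerivAt_right (hg.intervalIntegrable _ _)
    (hg.stronglyMeasurableAtFilter _ _) hg.continuousAt

lemma eq_mul_of_hasDerivAt_div_eq_zero {D : ℝ → ℝ} (hD : Differentiable ℝ D)
    (h : ∀ s, s ≠ 0 → HasDerivAt (fun t => D t / t) 0 s) : ∃ c, ∀ t, D t = c * t := by
  have hpos : ∀ t, 0 < t → D t = D 1 * t := by
    intro t ht
    have h1 : D t / t = D 1 / 1 := isOpen_Ioi.is_const_of_deriv_eq_zero isPreconnected_Ioi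
      (f := fun t => D t / t) (s := Set.Ioi (0 : ℝ))
      (fun s (hs : 0 < s) => (h s hs.ne').differentiableAt.differentiableWithinAt)
      (fun s (hs : 0 < s) => (h s hs.ne').deriv) ht (Set.mem_Ioi.2 one_pos)
    rw [div_one] at h1
    rw [← h1, div_mul_cancel₀ _ ht.ne']
  have hneg : ∀ t, t < 0 → D t = -D (-1) * t := by
    intro t ht
    have h1 : D t / t = D (-1) / (-1) := isOpen_Iio.is_const_of_deriv_eq_zero isPreconnected_Iio
      (f := fun t => D t / t) (s := Set.Iio (0 : ℝ))
      (fun s (hs : s < 0) => (h s hs.ne).differentiableAt.differentiableWithinAt)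
      (fun s (hs : s < 0) => (h s hs.ne).deriv) ht (by norm_num : (-1 : ℝ) < 0)
    rw [div_neg, div_one] at h1
    rw [← h1, div_mul_cancel₀ _ ht.ne]
  have h0 : D 0 = 0 := by
    have h1 : Filter.Tendsto D (nhdsWithin 0 (Set.Ioi 0)) (nhds (D 0)) :=
      (hD.continuous.tendsto 0).mono_left nhdsWithin_le_nhds
    have h2 : Filter.Tendsto (fun t => D 1 * t) (nhdsWithin 0 (Set.Ioi 0)) (nhds (D 1 * 0)) :=
      ((continuous_const.mul continuous_id).tendsto 0).mono_left nhdsWithin_le_nhds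
    have h3 := h2.congr' (by
      filter_upwards [self_mem_nhdsWithin] with t ht using (hpos t ht).symm)
    simpa using tendsto_nhds_unique h1 h3
  have hd : ∀ (c : ℝ) (S : Set ℝ), UniqueDiffWithinAt ℝ S 0 → (∀ t ∈ S, D t = c * t) →
      c = deriv D 0 := by
    intro c S hS hDc
    have h1 : HasDerivWithinAt (fun t => c * t) c S 0 := by
      simpa using ((hasDerivAt_id (0 : ℝ)).const_mul c).hasDerivWithinAt (s := S)
    exact hS.eq_deriv _ (h1.congr hDc (by simpa using h0)) (hD 0).hasDerivAt.hasDerivWithinAt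
  have c1 := hd (D 1) (Set.Ioi 0) (uniqueDiffWithinAt_Ioi 0) hpos
  have c2 := hd (-D (-1)) (Set.Iio 0) (uniqueDiffWithinAt_Iio 0) hneg
  refine ⟨deriv D 0, fun t => ?_⟩
  rcases lt_trichotomy t 0 with ht | rfl | ht
  · rw [← c2]; exact hneg t ht
  · simpa using h0
  · rw [← c1]; exact hpos t ht

/-- A determination of `s ∫ s^{2(j-1)} e^{-s²} ds`. -/
def mulPrimitive (j : ℕ) (s : ℝ) : ℝ :=
  (s ^ (2 * j) * Real.exp (-s ^ 2)
    + 2 * s * ∫ t in (0 : ℝ)..s, t ^ (2 * j) * Real.exp (-t ^ 2)) / (2 * j - 1)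

/-- The derivative of `mulPrimitive`. -/
def mulPrimitiveDeriv (j : ℕ) (s : ℝ) : ℝ :=
  ((2 * j : ℕ) * s ^ (2 * j - 1) * Real.exp (-s ^ 2)
    + 2 * ∫ t in (0 : ℝ)..s, t ^ (2 * j) * Real.exp (-t ^ 2)) / (2 * j - 1)

lemma two_mul_sub_one_ne_zero (j : ℕ) : (2 * j - 1 : ℝ) ≠ 0 := by
  intro h
  have : (2 * j : ℝ) = 1 := by linarith
  have : 2 * j = 1 := by exact_mod_cast this
  omega

lemma hasDerivAt_exp_neg_sq (s : ℝ) :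
    HasDerivAt (fun s : ℝ => Real.exp (-s ^ 2)) (Real.exp (-s ^ 2) * (-(2 * s))) s := by
  simpa using ((hasDerivAt_pow 2 s).neg).exp

lemma hasDerivAt_mulPrimitive (j : ℕ) (s : ℝ) :
    HasDerivAt (mulPrimitive j) (mulPrimitiveDeriv j s) s := by
  have hI := hasDerivAt_primitive
    (g := fun t : ℝ => t ^ (2 * j) * Real.exp (-t ^ 2)) (by fun_prop) s
  have h := (((hasDerivAt_pow (2 * j) s).mul (hasDerivAt_exp_neg_sq s)).add
    (((hasDerivAt_id s).const_mul 2).mul hI)).div_const (2 * j - 1 : ℝ)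
  refine HasDerivAt.congr_deriv h ?_
  rw [mulPrimitiveDeriv]
  congr 1
  simp only [id]
  ring

lemma mulPrimitive_sub (j : ℕ) (s : ℝ) :
    mulPrimitive j s - s * mulPrimitiveDeriv j s = -(s ^ (2 * j) * Real.exp (-s ^ 2)) := by
  have hj := two_mul_sub_one_ne_zero j
  have hs : s * ((2 * j : ℕ) * s ^ (2 * j - 1)) = (2 * j : ℝ) * s ^ (2 * j) := by
    rcases Nat.eq_zero_or_pos j with rfl | hj0
    · simp
    · push_cast
      rw [mul_left_comm, mul_pow_sub_one (by omega)]
  rw [mulPrimitive, mulPrimitiveDeriv]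
  field_simp
  linear_combination (-Real.exp (-s ^ 2)) * hs

lemma contDiff_mulPrimitiveDeriv (j : ℕ) : ContDiff ℝ ∞ (mulPrimitiveDeriv j) := by
  have hI : ContDiff ℝ ∞ fun s : ℝ => ∫ t in (0 : ℝ)..s, t ^ (2 * j) * Real.exp (-t ^ 2) :=
    contDiff_of_hasDerivAt (hasDerivAt_primitive (by fun_prop)) (by fun_prop)
  unfold mulPrimitiveDeriv
  fun_prop

lemma IsMulPrimitive.exists_hasDerivAt {j : ℕ} {Φ : ℝ → ℝ}
    (hΦ : IsMulPrimitive (2 * ((j : ℤ) - 1)) Φ) :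
    ∃ Φ' : ℝ → ℝ, ContDiff ℝ ∞ Φ' ∧ (∀ s, HasDerivAt Φ (Φ' s) s) ∧
      ∀ s, Φ s - s * Φ' s = -(s ^ (2 * j) * Real.exp (-s ^ 2)) := by
  obtain ⟨c, hc⟩ := eq_mul_of_hasDerivAt_div_eq_zero (D := fun s => Φ s - mulPrimitive j s)
    (hΦ.1.sub fun s => (hasDerivAt_mulPrimitive j s).differentiableAt) (by
      intro s hs
      have h := (hΦ.2 s hs).sub ((hasDerivAt_mulPrimitive j s).div (hasDerivAt_id s) hs)
      have e : (fun t => (Φ t - mulPrimitive j t) / t) =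
          (fun t => Φ t / t) - mulPrimitive j / id := by
        ext t; simp [sub_div]
      rw [e]
      refine HasDerivAt.congr_deriv h ?_
      have hz : s ^ (2 * ((j : ℤ) - 1)) = s ^ (2 * j) / s ^ 2 := by
        rw [mul_sub, zpow_sub₀ hs]
        norm_cast
      have h1 := mulPrimitive_sub j s
      rw [hz]
      simp only [id, mul_one]
      field_simp
      linear_combination h1)
  have e : Φ = fun s => mulPrimitive j s + c * s := by
    ext s
    linarith [hc s]
  refine ⟨fun s => mulPrimitiveDeriv j s + c, (contDiff_mulPrimitiveDeriv j).add contDiff_const,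
    fun s => ?_, fun s => ?_⟩
  · rw [e]
    have := (hasDerivAt_mulPrimitive j s).add ((hasDerivAt_id s).const_mul c)
    exact HasDerivAt.congr_deriv this (by simp)
  · rw [e]
    linear_combination mulPrimitive_sub j s

lemma hasDerivAt_erf (s : ℝ) :
    HasDerivAt erf (2 / Real.sqrt Real.pi * Real.exp (-s ^ 2)) s :=
  (hasDerivAt_primitive (g := fun t : ℝ => Real.exp (-t ^ 2)) (by fun_prop) s).const_mul _

lemma contDiff_erf : ContDiff ℝ ∞ erf :=
  contDiff_of_hasDerivAt hasDerivAt_erf (by fun_prop)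

/-- The part of `φ_m` that does not involve `h`, as a function of `u = r²` and `s`. -/
def potential (m : ℕ) (γ ε : ℝ) (Φ : ℕ → ℝ → ℝ) (u s : ℝ) : ℝ :=
  -γ * ∑ i ∈ Finset.range (m + 1),
      (-1) ^ (m - i) * (m.choose i : ℝ) * u ^ i * Real.exp u * Φ i s
    + ε * (Real.exp u * Real.sqrt Real.pi * (s * erf s) + Real.exp u * Real.exp (-s ^ 2))

/-- The derivative of the potential in `s`. -/
def potentialDeriv (m : ℕ) (γ ε : ℝ) (Φ' : ℕ → ℝ → ℝ) (u s : ℝ) : ℝ :=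
  -γ * ∑ i ∈ Finset.range (m + 1),
      (-1) ^ (m - i) * (m.choose i : ℝ) * u ^ i * Real.exp u * Φ' i s
    + ε * (Real.exp u * Real.sqrt Real.pi * erf s)

lemma phi_eq_potential (m : ℕ) (γ ε : ℝ) (h : ℝ → ℝ) (Φ : ℕ → ℝ → ℝ) (r s : ℝ) :
    phi m γ ε h Φ r s = s * h r + potential m γ ε Φ (r ^ 2) s := by
  have h1 : Real.exp (-s ^ 2) * Real.exp (s ^ 2) = 1 := by
    rw [← Real.exp_add]; simp
  simp only [phi, potential, pow_mul, sub_eq_add_neg, Real.exp_add]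
  linear_combination (ε * Real.exp (r ^ 2) * Real.sqrt Real.pi * s * erf s) * h1

lemma isFlatPotential_potential (m : ℕ) (γ ε : ℝ) {Φ Φ' : ℕ → ℝ → ℝ}
    (hc : ∀ i ≤ m, ContDiff ℝ ∞ (Φ' i)) (hd : ∀ i ≤ m, ∀ s, HasDerivAt (Φ i) (Φ' i s) s)
    (he : ∀ i ≤ m, ∀ s, Φ i s - s * Φ' i s = -(s ^ (2 * (m - i)) * Real.exp (-s ^ 2))) :
    IsFlatPotential (potential m γ ε Φ)
      (fun u s => Real.exp (u - s ^ 2) * (γ * (u - s ^ 2) ^ m + ε))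
      (potentialDeriv m γ ε Φ')
      (fun u s => Real.exp (u - s ^ 2) *
        (γ * (u - s ^ 2) ^ m + ε + γ * (m * (u - s ^ 2) ^ (m - 1)))) := by
  have hmem : ∀ i ∈ Finset.range (m + 1), i ≤ m := fun i hi => by
    rw [Finset.mem_range] at hi; omega
  have hpi : Real.sqrt Real.pi ≠ 0 := (Real.sqrt_pos.2 Real.pi_pos).ne'
  have herf := contDiff_erf
  have hsmooth : ∀ {G : ℕ → ℝ → ℝ}, (∀ i ≤ m, ContDiff ℝ ∞ (G i)) →
      ContDiff ℝ ∞ fun p : ℝ × ℝ => ∑ i ∈ Finset.range (m + 1),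
        (-1) ^ (m - i) * (m.choose i : ℝ) * p.1 ^ i * Real.exp p.1 * G i p.2 := by
    intro G hG
    refine ContDiff.sum fun i hi => ?_
    have := hG i (hmem i hi)
    fun_prop
  have hderiv : ∀ u s, HasDerivAt (potential m γ ε Φ u) (potentialDeriv m γ ε Φ' u s) s := by
    intro u s
    have h1 : HasDerivAt (fun s => ∑ i ∈ Finset.range (m + 1),
        (-1) ^ (m - i) * (m.choose i : ℝ) * u ^ i * Real.exp u * Φ i s)
        (∑ i ∈ Finset.range (m + 1),
          (-1) ^ (m - i) * (m.choose i : ℝ) * u ^ i * Real.exp u * Φ' i s) s :=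
      HasDerivAt.fun_sum fun i hi => (hd i (hmem i hi) s).const_mul _
    have h2 := ((((hasDerivAt_id s).mul (hasDerivAt_erf s)).const_mul
      (Real.exp u * Real.sqrt Real.pi)).add
        ((hasDerivAt_exp_neg_sq s).const_mul (Real.exp u))).const_mul ε
    refine HasDerivAt.congr_deriv ((h1.const_mul (-γ)).add h2) ?_
    simp only [potentialDeriv, id]
    have h3 : Real.sqrt Real.pi * (2 / Real.sqrt Real.pi) = 2 := mul_div_cancel₀ _ hpi
    linear_combination (ε * Real.exp u * s * Real.exp (-s ^ 2)) * h3
  have hB : ContDiff ℝ ∞ fun p : ℝ × ℝ => potentialDeriv m γ ε Φ' p.1 p.2 := by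
    have := hsmooth hc
    unfold potentialDeriv
    fun_prop
  have hadd : ∀ u s, potential m γ ε Φ u s =
      Real.exp (u - s ^ 2) * (γ * (u - s ^ 2) ^ m + ε) + s * potentialDeriv m γ ε Φ' u s := by
    intro u s
    have h1 : ∑ i ∈ Finset.range (m + 1),
          (-1) ^ (m - i) * (m.choose i : ℝ) * u ^ i * Real.exp u * Φ i s =
        -(Real.exp u * Real.exp (-s ^ 2) * (u - s ^ 2) ^ m) +
          s * ∑ i ∈ Finset.range (m + 1),
            (-1) ^ (m - i) * (m.choose i : ℝ) * u ^ i * Real.exp u * Φ' i s := by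
      rw [sub_eq_add_neg, add_pow, Finset.mul_sum, Finset.mul_sum, ← Finset.sum_neg_distrib,
        ← Finset.sum_add_distrib]
      refine Finset.sum_congr rfl fun i hi => ?_
      rw [neg_pow (s ^ 2), ← pow_mul]
      linear_combination ((-1) ^ (m - i) * (m.choose i : ℝ) * u ^ i * Real.exp u) *
        he i (hmem i hi) s
    rw [potential, potentialDeriv, h1, sub_eq_add_neg u, Real.exp_add]
    ring
  have hu : ∀ u s : ℝ, HasDerivAt (fun u : ℝ => u - s ^ 2) 1 u :=
    fun u s => (hasDerivAt_id u).sub_const _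
  have hs' : ∀ u s : ℝ, HasDerivAt (fun s : ℝ => u - s ^ 2) (-(2 * s)) s := by
    intro u s
    simpa using (hasDerivAt_pow 2 s).const_sub u
  refine ⟨?_, by fun_prop, hB, hadd, hderiv, ?_, ?_⟩
  · have := hsmooth (G := Φ) fun i hi => contDiff_of_hasDerivAt (hd i hi) (hc i hi)
    unfold potential
    fun_prop
  · intro u
    have hBu : ContDiff ℝ ∞ (potentialDeriv m γ ε Φ' u) :=
      hB.comp (contDiff_const.prodMk contDiff_id)
    have hBd : ∀ s, HasDerivAt (potentialDeriv m γ ε Φ' u)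
        (deriv (potentialDeriv m γ ε Φ' u) s) s :=
      fun s => (hBu.differentiable (by simp) s).hasDerivAt
    have heq : deriv (potentialDeriv m γ ε Φ' u) = fun s => 2 * (Real.exp (u - s ^ 2) *
        (γ * (u - s ^ 2) ^ m + ε + γ * (m * (u - s ^ 2) ^ (m - 1)))) := by
      refine Continuous.ext_on (dense_compl_singleton (0 : ℝ))
        ((contDiff_infty_iff_deriv.1 hBu).2.continuous) (by fun_prop) fun s hs => ?_
      have hA := (hs' u s).exp.mul ((((hs' u s).pow m).const_mul γ).add_const ε)
      have h1 := hA.add ((hasDerivAt_id s).mul (hBd s))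
      have h2 : HasDerivAt (potential m γ ε Φ u) _ s :=
        HasDerivAt.congr_of_eventuallyEq h1 (Filter.Eventually.of_forall fun s => hadd u s)
      have h3 := h2.unique (hderiv u s)
      refine mul_left_cancel₀ hs ?_
      simp only [id, one_mul, Pi.pow_apply] at h3
      linear_combination h3
    intro s
    have := hBd s
    rwa [heq] at this
  · intro u s
    have h1 := (hu u s).exp.mul ((((hu u s).pow m).const_mul γ).add_const ε)
    refine HasDerivAt.congr_deriv h1 ?_
    simp only [Pi.pow_apply]
    ring

end SphFinsler

end

theorem mainTheorem6 (n m : ℕ) (M : Set (SphFinsler.E n)) (hM : SphFinsler.IsSymmetricDomain M)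
    (γ ε : ℝ) (hγ : 0 ≤ γ) (hε : 0 < ε)
    (h : ℝ → ℝ) (hh : ContDiffOn ℝ ∞ (fun x : SphFinsler.E n => h ‖x‖) M)
    (Φ : ℕ → ℝ → ℝ)
    (hΦ : ∀ i ≤ m, SphFinsler.IsMulPrimitive (2 * ((m : ℤ) - (i : ℤ) - 1)) (Φ i))
    (hpos : ∀ x ∈ M, ∀ s : ℝ, |s| ≤ ‖x‖ → 0 < SphFinsler.phi m γ ε h Φ ‖x‖ s) :
    SphFinsler.IsFinslerMetric M (SphFinsler.sphericalMetric (SphFinsler.phi m γ ε h Φ)) ∧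
    SphFinsler.IsProjectivelyFlat M (SphFinsler.sphericalMetric (SphFinsler.phi m γ ε h Φ)) ∧
    SphFinsler.HasScalarFlagCurvature M
      (SphFinsler.sphericalMetric (SphFinsler.phi m γ ε h Φ)) := by
  have hex : ∀ i, ∃ Φ' : ℝ → ℝ, i ≤ m → ContDiff ℝ ∞ Φ' ∧ (∀ s, HasDerivAt (Φ i) (Φ' s) s) ∧
      ∀ s, Φ i s - s * Φ' s = -(s ^ (2 * (m - i)) * Real.exp (-s ^ 2)) := by
    intro i
    by_cases hi : i ≤ m
    · have h1 := hΦ i hi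
      rw [← Nat.cast_sub hi] at h1
      obtain ⟨Φ', h2⟩ := h1.exists_hasDerivAt
      exact ⟨Φ', fun _ => h2⟩
    · exact ⟨0, fun h => absurd h hi⟩
  choose Φ' hΦ' using hex
  refine SphFinsler.sphericalMetric_of_isFlatPotential hM hh
    (SphFinsler.isFlatPotential_potential m γ ε (fun i hi => (hΦ' i hi).1)
      (fun i hi => (hΦ' i hi).2.1) fun i hi => (hΦ' i hi).2.2) ?_ ?_
    (SphFinsler.phi_eq_potential m γ ε h Φ) hpos
  · intro u s hsu
    have := sub_nonneg.2 hsu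
    positivity
  · intro u s hsu
    have := sub_nonneg.2 hsu
    positivity
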